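/- Let $N$ be a connected nilpotent (finite-dimensional real) Lie group acting real-analytically on a connected $1$-dimensional real-analytic manifold $X$ (Hausdorff, second countable, without boundary), i.e. the action map $N\times X\to X$ is real-analytic. Suppose that $N$ has no common fixed point: there is no $x\in X$ with $n\cdot x=x$ for all $n\in N$. Then there is a real-analytic Riemannian metric $g$ on $X$ such that: 1. $g$ is $N$-invariant, i.e. every $n\in N$ acts on $X$ by an isometry of $g$. 2. $g$ is flat, i.e. around every point of $X$ there is an analytic coordinate system that is an isometry onto an open subset of a Euclidean space. 3. $g$ is unique up to a constant: every continuous $N$-invariant Riemannian metric $g'$ on $X$ is of the form $g'=c\,g$ for a constant $c>0$. 4. $X$ is identified with one of the abelian groups $\mathbb{R}$ or $\mathrm{SO}(2)$, with $N$ acting by translations through a homomorphism into that group. That is, for $A=\mathbb{R}$ or for $A=\mathrm{SO}(2)=\{z\in\mathbb{C}:|z|=1\}$ there are a real-analytic diffeomorphism $\Phi:X\to A$ and a real-analytic group homomorphism $\rho:N\to A$ such that $\Phi(n\cdot x)=\rho(n)\,\Phi(x)$ for all $n\in N$ and $x\in X$ (written additively, $\Phi(n\cdot x)=\rho(n)+\Phi(x)$,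 when $A=\mathbb{R}$). Moreover, $g=c\,\Phi^*g_A$ for some constant $c>0$, where $g_A$ is the standard metric of $\mathbb{R}$, respectively the metric induced on the unit circle by $\mathbb{C}$. -/

import Mathlib

open scoped Manifold ContDiff
open Bundle

noncomputable section

namespace LineAction

variable {F : Type*} [NormedAddCommGroup F] [NormedSpace ℝ F]
  {X : Type*} [TopologicalSpace X] [ChartedSpace F X]

/-- The value at `x`, on tangent vectors `v` and `w`, of the pullback by `f : X → V` of the standard
(constant) Riemannian metric of the inner product space `V`. -/
def pullbackMetric {V : Type*} [NormedAddCommGroup V] [InnerProductSpace ℝ V]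
    (f : X → V) (x : X) (v w : TangentSpace 𝓘(ℝ, F) x) : ℝ :=
  inner ℝ (mfderiv 𝓘(ℝ, F) 𝓘(ℝ, V) f x v : V) (mfderiv 𝓘(ℝ, F) 𝓘(ℝ, V) f x w : V)

/-- The field of bilinear forms `g` is invariant under the action of `N`: every `n : N` acts on `X`
by an isometry of `g`. -/
def IsInvariantMetric (N : Type*) [SMul N X]
    (g : ∀ x : X, TangentSpace 𝓘(ℝ, F) x →L[ℝ] TangentSpace 𝓘(ℝ, F) x →L[ℝ] ℝ) : Prop :=
  ∀ (n : N) (x : X) (v w : TangentSpace 𝓘(ℝ, F) x),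
    g (n • x) (mfderiv 𝓘(ℝ, F) 𝓘(ℝ, F) (fun y : X => n • y) x v)
      (mfderiv 𝓘(ℝ, F) 𝓘(ℝ, F) (fun y : X => n • y) x w) = g x v w

/-- The metric `g` is flat: around every point there is an analytic coordinate system that is an
isometry onto an open subset of Euclidean space of dimension `dim X`. -/
def IsFlatMetric
    (g : ∀ x : X, TangentSpace 𝓘(ℝ, F) x →L[ℝ] TangentSpace 𝓘(ℝ, F) x →L[ℝ] ℝ) : Prop :=
  ∀ x : X, ∃ e : OpenPartialHomeomorph X (EuclideanSpace ℝ (Fin (Module.finrank ℝ F))),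
    x ∈ e.source ∧
    ContMDiffOn 𝓘(ℝ, F) (𝓡 (Module.finrank ℝ F)) ω e e.source ∧
    ContMDiffOn (𝓡 (Module.finrank ℝ F)) 𝓘(ℝ, F) ω e.symm e.target ∧
    ∀ y ∈ e.source, ∀ v w : TangentSpace 𝓘(ℝ, F) y, g y v w = pullbackMetric e y v w

end LineAction

end

/-!
The dimension of `X` enters through one observation: a nonconstant analytic map from a connected
manifold to `X` has a nonzero derivative somewhere, hence an image with an interior point
(`range_mem_nhds_of_ne`). Applied to the orbit maps, it shows that an action without common fixed
point has open orbits and is therefore transitive (`isPretransitive_of_no_fixedPoint`).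

Applied to commutators, the same observation shows that the action is commutative
(`smul_smul_comm_of_isPretransitive`). Consider the last term `Γ` of the lower central series that
acts nontrivially. If it lies inside the commutator subgroup, some commutator in it moves a point,
so `Γ` is transitive by the observation. As `Γ` acts by transformations commuting with all of `N`,
every element of `N` acts like an element of `Γ`, so commutators of `N` act trivially: a
contradiction. No closedness of the terms of the series is needed, since only images of analytic
maps from `N` occur.

A transitive commutative action is free modulo its kernel. A curve in `N` moving a point with
nonzero speed has a velocity field `Z` which `N` preserves, by commutativity. The coordinate `u`
with `du = dt / Z` turns the transformations of `N` into local translations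
(`smul_parametrization_eq_add`). The local one-parameter group of translations extends algebraically
to a one-parameter group of transformations (`exists_monoidHom_eq_of_local_add`), and an orbit of
the latter is the developing map `φ : ℝ → X`: a surjective analytic local diffeomorphism for which
`N` acts by translations of `ℝ` (`exists_equivariant_isLocalDiffeomorph`).

The periods of `φ` form a discrete subgroup of `ℝ` (`injective_or_periodic`). Hence `φ` has the same
fibres as the identity of `ℝ` or, after rescaling, as the exponential map of the circle, and `X` is
identified with `ℝ` or with the circle (`exists_diffeomorph_comp_eq`). The metric is the pullback of
the standard one; it is Euclidean in the coordinate given by local inverses of `φ`, and its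
uniqueness up to a constant follows from transitivity and `dim X = 1`
(`IsInvariantMetric.eq_const_mul`).
-/

namespace LineAction

open Filter Topology Set
open scoped commutatorElement

/-! ### Extending local homomorphisms of the real line -/

/-- A map from `ℝ` to a group which is additive near `0` agrees near `0` with a homomorphism defined
on all of `ℝ`, namely `t ↦ f (t / k) ^ k` for any large integer `k`. The group need not be
topological, and `f` need not be continuous. -/
theorem exists_monoidHom_eq_of_local_add {G : Type*} [Group G] {δ : ℝ} (hδ : 0 < δ) (f : ℝ → G)
    (hf : ∀ s t, |s| < δ → |t| < δ → |s + t| < δ → f (s + t) = f s * f t) :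
    ∃ φ : Multiplicative ℝ →* G, ∀ t, |t| < δ → φ (.ofAdd t) = f t := by
  have hpow : ∀ (m : ℕ) (t : ℝ), |(m : ℝ) * t| < δ → |t| < δ → f (m * t) = f t ^ m := by
    intro m
    induction m with
    | zero =>
      intro t _ _
      have h := hf 0 0 (by simpa) (by simpa) (by simpa)
      simpa using h
    | succ m ih =>
      intro t h1 h2
      have h3 : |(m : ℝ) * t| < δ := by
        refine lt_of_le_of_lt ?_ h1
        rw [abs_mul, abs_mul, Nat.abs_cast, Nat.abs_cast]
        gcongr
        simp
      have h4 : ((m + 1 : ℕ) : ℝ) * t = m * t + t := by push_cast; ring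
      rw [h4, hf _ _ h3 h2 (h4 ▸ h1), ih t h3 h2, pow_succ]
  have hsmall : ∀ t : ℝ, ∃ m : ℕ, 0 < m ∧ ∀ k : ℕ, m ≤ k → |t / k| < δ := by
    intro t
    obtain ⟨m, hm⟩ := exists_nat_gt (|t| / δ)
    have hm0 : (0 : ℝ) < m := lt_of_le_of_lt (by positivity) hm
    refine ⟨m, by exact_mod_cast hm0, fun k hk => ?_⟩
    have hk0 : (m : ℝ) ≤ k := by exact_mod_cast hk
    rw [abs_div, Nat.abs_cast, div_lt_iff₀ (by linarith)]
    rw [div_lt_iff₀ hδ] at hm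
    nlinarith
  choose m hm0 hm using hsmall
  -- The value `f (t / k) ^ k` does not depend on the large integer `k`.
  have hindep : ∀ (t : ℝ) (k l : ℕ), 0 < k → 0 < l → |t / k| < δ → |t / l| < δ →
      f (t / k) ^ k = f (t / l) ^ l := by
    intro t k l hk hl h1 h2
    have hk' : (k : ℝ) ≠ 0 := by positivity
    have hl' : (l : ℝ) ≠ 0 := by positivity
    have hkl : |t / (k * l : ℝ)| < δ := by
      refine lt_of_le_of_lt ?_ h1
      rw [← div_div, abs_div (t / k), Nat.abs_cast]
      exact div_le_self (abs_nonneg _) (by exact_mod_cast hl)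
    have e1 : t / k = l * (t / (k * l : ℝ)) := by field_simp
    have e2 : t / l = k * (t / (k * l : ℝ)) := by field_simp
    have h1' := hpow l _ (e1 ▸ h1) hkl
    have h2' := hpow k _ (e2 ▸ h2) hkl
    rw [← e1] at h1'
    rw [← e2] at h2'
    rw [h1', h2', ← pow_mul, ← pow_mul, mul_comm l k]
  -- Small values commute since addition does, so that `(f (s / k) * f (t / k)) ^ k` splits.
  have hcomm : ∀ s t, |s| < δ → |t| < δ → |s + t| < δ → Commute (f s) (f t) := by
    intro s t h1 h2 h3
    rw [Commute, SemiconjBy, ← hf s t h1 h2 h3, ← hf t s h2 h1 (by rwa [add_comm]), add_comm]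
  refine ⟨MonoidHom.mk' (fun t => f (t.toAdd / m t.toAdd) ^ m t.toAdd) fun s t => ?_,
    fun t ht => ?_⟩
  · set a := s.toAdd
    set b := t.toAdd
    have hab : (s * t).toAdd = a + b := rfl
    rw [hab]
    set k := m a + m b + m (a + b)
    have hk : 0 < k := by have := hm0 a; omega
    have ha := hm a k (by omega)
    have hb := hm b k (by omega)
    have hc := hm (a + b) k (by omega)
    rw [hindep _ _ k (hm0 _) hk (hm _ _ le_rfl) hc, hindep a _ k (hm0 _) hk (hm _ _ le_rfl) ha,
      hindep b _ k (hm0 _) hk (hm _ _ le_rfl) hb, add_div]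
    rw [add_div] at hc
    rw [hf _ _ ha hb hc, (hcomm _ _ ha hb hc).mul_pow]
  · change f (t / m t) ^ m t = f t
    have := hindep t (m t) 1 (hm0 _) one_pos (hm _ _ le_rfl) (by simpa)
    simpa using this

/-! ### Analytic primitives -/

theorem exists_analyticAt_primitive {h : ℝ → ℝ} (hh : AnalyticAt ℝ h 0) :
    ∃ u : ℝ → ℝ, AnalyticAt ℝ u 0 ∧ u 0 = 0 ∧ ∀ᶠ t in 𝓝 0, HasDerivAt u (h t) t := by
  obtain ⟨p, r, hp⟩ := hh
  -- Integrate the power series of `h` term by term. The coefficient `b 0` is `0` because of the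
  -- convention for division by zero, which gives `u 0 = 0`.
  let b : ℕ → ℝ := fun n => p.coeff (n - 1) / n
  let q : FormalMultilinearSeries ℝ ℝ ℝ := FormalMultilinearSeries.ofScalars ℝ b
  obtain ⟨ρ, hρ0, hρr⟩ := ENNReal.lt_iff_exists_nnreal_btwn.1 hp.r_pos
  have hρ : 0 < ρ := by exact_mod_cast hρ0
  obtain ⟨C, hC, hpC⟩ := p.norm_mul_pow_le_of_lt_radius (hρr.trans_le hp.r_le)
  have hq : (ρ : ENNReal) ≤ q.radius := by
    refine q.le_radius_of_bound (C * ρ) fun n => ?_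
    rw [FormalMultilinearSeries.ofScalars_norm]
    rcases n with _ | n
    · simp only [b, Nat.cast_zero, div_zero, norm_zero, zero_mul]; positivity
    · have h1 : ‖b (n + 1)‖ ≤ ‖p n‖ := by
        simp only [b, Nat.add_sub_cancel, norm_div]
        rw [← FormalMultilinearSeries.norm_apply_eq_norm_coef]
        refine div_le_self (norm_nonneg _) ?_
        rw [Real.norm_natCast]; exact_mod_cast Nat.succ_pos n
      calc ‖b (n + 1)‖ * ρ ^ (n + 1) ≤ ‖p n‖ * ρ ^ (n + 1) := by gcongr
        _ = (‖p n‖ * ρ ^ n) * ρ := by ring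
        _ ≤ C * ρ := by gcongr; exact hpC n
  have hqpos : 0 < q.radius := hρ0.trans_le hq
  have hQ : HasFPowerSeriesOnBall q.sum q 0 ρ := (q.hasFPowerSeriesOnBall hqpos).mono hρ0 hq
  refine ⟨q.sum, hQ.analyticAt, ?_, ?_⟩
  · have := hQ.coeff_zero (fun _ => 0)
    rw [← this]
    simp [q, b]
  · filter_upwards [Metric.eball_mem_nhds (0 : ℝ) hρ0] with t ht
    have hd : DifferentiableAt ℝ q.sum t :=
      (hQ.analyticAt_of_mem ht).differentiableAt
    suffices hderiv : h t = deriv q.sum t by rw [hderiv]; exact hd.hasDerivAt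
    have h1 := (ContinuousLinearMap.apply ℝ ℝ (1 : ℝ)).hasSum (hQ.fderiv.hasSum ht)
    have h2 := hp.hasSum (Metric.eball_subset_eball hρr.le ht)
    simp only [zero_add] at h1 h2
    rw [← fderiv_apply_one_eq_deriv]
    change HasSum _ (fderiv ℝ q.sum t 1) at h1
    refine h2.unique ((funext fun n => ?_ : (fun n => p n fun _ => t) = _) ▸ h1)
    rw [FormalMultilinearSeries.apply_eq_pow_smul_coeff,
      FormalMultilinearSeries.apply_eq_pow_smul_coeff, map_smul]
    congr 1
    simp [FormalMultilinearSeries.derivSeries_coeff_one, q, b]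
    field_simp

/-! ### Criteria for transitivity and commutativity -/

/-- An action of a nilpotent group is commutative as soon as any commutator `⁅c, n⁆`, with `c` in a
term of the lower central series, that moves a point forces the next term to be transitive. Indeed,
suppose that the next term commutes with the action of `G`. If it is transitive, then `c` agrees at
`x₀` with one of its elements, hence everywhere, and so `c` commutes with `n`; thus no such
commutator can move a point. Going down the lower central series, all commutators act trivially. -/
theorem smul_smul_comm_of_isNilpotent {G X : Type*} [Group G] [Group.IsNilpotent G] [MulAction G X]
    (h : ∀ (k : ℕ) (c n : G) (x₀ : X), c ∈ (⊤ : Subgroup G).lowerCentralSeries k →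
      ⁅c, n⁆ • x₀ ≠ x₀ →
      ∀ x y : X, ∃ g ∈ (⊤ : Subgroup G).lowerCentralSeries (k + 1), g • x = y)
    (a b : G) (x : X) : a • b • x = b • a • x := by
  set K := (MulAction.toPermHom G X).ker with hK
  have mem_K : ∀ g : G, g ∈ K ↔ ∀ x : X, g • x = x := fun g => by
    simp [hK, MonoidHom.mem_ker, Equiv.ext_iff]
  have comm_of : ∀ {a b : G}, ⁅a, b⁆ ∈ K → ∀ x : X, a • b • x = b • a • x := fun {a b} hab x => by
    have := (mem_K _).1 hab (b • a • x)
    rw [← this]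
    simp [commutatorElement_def, mul_smul]
  have step : ∀ j, (⊤ : Subgroup G).lowerCentralSeries (j + 2) ≤ K →
      (⊤ : Subgroup G).lowerCentralSeries (j + 1) ≤ K := by
    intro j hj
    rw [Subgroup.lowerCentralSeries_succ, Subgroup.commutator_le] at hj ⊢
    intro c hc n _
    rw [mem_K]
    intro x₀
    by_contra hne
    -- The group `lowerCentralSeries (j + 1)` acts transitively and commutes with the action of `G`,
    -- so every element of `G` acts as one of its elements.
    have htrans := h j c n x₀ hc hne
    have hcen : ∀ d ∈ (⊤ : Subgroup G).lowerCentralSeries (j + 1), ∀ (g : G) (x : X),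
        d • g • x = g • d • x := fun d hd g x => comm_of (hj d hd g trivial) x
    obtain ⟨d, hd, hdx⟩ := htrans x₀ (c • x₀)
    have hcd : ∀ x : X, c • x = d • x := by
      intro x
      obtain ⟨e, he, rfl⟩ := htrans x₀ x
      rw [← hcen e he, ← hdx, hcen e he]
    apply hne
    have h1 : c • n • (c⁻¹ • n⁻¹ • x₀) = n • c • (c⁻¹ • n⁻¹ • x₀) := by
      rw [hcd, hcen d hd, ← hcd]
    rw [commutatorElement_def, mul_smul, mul_smul, mul_smul, h1]
    simp
  have hall : ∀ m, (⊤ : Subgroup G).lowerCentralSeries (m + 1) ≤ K →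
      (⊤ : Subgroup G).lowerCentralSeries 1 ≤ K := by
    intro m
    induction m with
    | zero => exact id
    | succ m ih => exact fun hm => ih (step m hm)
  obtain ⟨m, hm⟩ := Subgroup.nilpotent_iff_lowerCentralSeries.1 ‹Group.IsNilpotent G›
  have h1 := hall m (((⊤ : Subgroup G).lowerCentralSeries_antitone m.le_succ).trans
    (hm.le.trans bot_le))
  rw [Subgroup.lowerCentralSeries_succ, Subgroup.commutator_le] at h1
  exact comm_of (h1 a trivial b trivial) x

/-- On a connected space, an action by homeomorphisms is transitive if every orbit has an interior
point: the orbits are then open, hence clopen. -/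
theorem isPretransitive_of_orbit_mem_nhds {G X : Type*} [Group G] [TopologicalSpace X]
    [PreconnectedSpace X] [MulAction G X] [ContinuousConstSMul G X]
    (h : ∀ x : X, ∃ y ∈ MulAction.orbit G x, MulAction.orbit G x ∈ 𝓝 y) :
    MulAction.IsPretransitive G X := by
  have hopen : ∀ x : X, IsOpen (MulAction.orbit G x) := by
    intro x
    rw [isOpen_iff_mem_nhds]
    intro z hz
    obtain ⟨y, hy, hn⟩ := h x
    obtain ⟨g, rfl⟩ : ∃ g : G, g • y = z := by
      rw [MulAction.orbit_eq_iff.2 hy |>.symm] at hz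
      exact hz
    have := (smul_mem_nhds_smul_iff g).2 hn
    rwa [MulAction.smul_orbit] at this
  have hclosed : ∀ x : X, IsClosed (MulAction.orbit G x) := by
    intro x
    rw [← isOpen_compl_iff, isOpen_iff_mem_nhds]
    intro z hz
    refine mem_of_superset ((hopen z).mem_nhds (MulAction.mem_orbit_self z)) fun w hw hw' => hz ?_
    rw [← MulAction.orbit_eq_iff] at hw hw' ⊢
    rw [← hw, hw']
  refine ⟨fun x y => ?_⟩
  have : MulAction.orbit G x = univ :=
    IsClopen.eq_univ ⟨hclosed x, hopen x⟩ ⟨x, MulAction.mem_orbit_self x⟩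
  exact this.symm.subset (mem_univ y)

/-! ### Maps with vanishing derivative -/

section Manifold

variable {E : Type*} [NormedAddCommGroup E] [NormedSpace ℝ E]
  {M : Type*} [TopologicalSpace M] [ChartedSpace E M]
  {F : Type*} [NormedAddCommGroup F] [NormedSpace ℝ F]
  {X : Type*} [TopologicalSpace X] [ChartedSpace F X]

theorem isLocallyConstant_of_mfderiv_eq_zero [IsManifold 𝓘(ℝ, E) 1 M] [IsManifold 𝓘(ℝ, F) 1 X]
    {f : M → X} (hf : MDifferentiable 𝓘(ℝ, E) 𝓘(ℝ, F) f)
    (h0 : ∀ m, mfderiv 𝓘(ℝ, E) 𝓘(ℝ, F) f m = 0) : IsLocallyConstant f := by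
  rw [IsLocallyConstant.iff_eventually_eq]
  intro m
  set e := extChartAt 𝓘(ℝ, E) m with he
  set e' := extChartAt 𝓘(ℝ, F) (f m) with he'
  have hcont : ContinuousAt (fun y => f (e.symm y)) (e m) :=
    ContinuousAt.comp (by rw [extChartAt_to_inv]; exact (hf m).continuousAt)
      (continuousAt_extChartAt_symm m)
  have hnhds : ∀ᶠ y in 𝓝 (e m), y ∈ e.target ∧ f (e.symm y) ∈ e'.source :=
    Filter.Eventually.and (extChartAt_target_mem_nhds m)
      (hcont.preimage_mem_nhds (by
        simp only [extChartAt_to_inv, he]; exact extChartAt_source_mem_nhds (f m)))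
  obtain ⟨r, hr, hball⟩ := Metric.eventually_nhds_iff_ball.1 hnhds
  have hderiv : ∀ y ∈ Metric.ball (e m) r,
      HasMFDerivAt 𝓘(ℝ, E) 𝓘(ℝ, F) (fun y => e' (f (e.symm y))) y 0 := by
    intro y hy
    obtain ⟨h1, h2⟩ := hball y hy
    have d1 : MDifferentiableAt 𝓘(ℝ, E) 𝓘(ℝ, E) e.symm y :=
      ((contMDiffOn_extChartAt_symm (n := 1) m).contMDiffAt
        ((isOpen_extChartAt_target m).mem_nhds h1)).mdifferentiableAt one_ne_zero
    have d3 : MDifferentiableAt 𝓘(ℝ, F) 𝓘(ℝ, F) e' (f (e.symm y)) :=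
      (contMDiffAt_extChartAt' (n := 1) (by simpa [he'] using h2)).mdifferentiableAt one_ne_zero
    have d2 := (hf (e.symm y)).hasMFDerivAt
    rw [h0] at d2
    have := d3.hasMFDerivAt.comp y (d2.comp y d1.hasMFDerivAt)
    convert! this using 1
    ext v
    simp
  have hpre : IsPreconnected (Metric.ball (e m) r) := (convex_ball (e m) r).isPreconnected
  have hd : ∀ y ∈ Metric.ball (e m) r,
      HasFDerivAt (fun y => e' (f (e.symm y))) (0 : E →L[ℝ] F) y :=
    fun y hy => hasMFDerivAt_iff_hasFDerivAt.1 (hderiv y hy)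
  have hconst : ∀ y ∈ Metric.ball (e m) r, e' (f (e.symm y)) = e' (f (e.symm (e m))) := by
    intro y hy
    refine Metric.isOpen_ball.is_const_of_fderiv_eq_zero (𝕜 := ℝ)
      (f := fun y => e' (f (e.symm y))) hpre
      (fun z hz => (hd z hz).differentiableAt.differentiableWithinAt)
      (fun z hz => (hd z hz).fderiv) hy (Metric.mem_ball_self hr)
  have hc : ContinuousAt e m := continuousAt_extChartAt m
  filter_upwards [hc.preimage_mem_nhds (Metric.ball_mem_nhds _ hr),
    extChartAt_source_mem_nhds (I := 𝓘(ℝ, E)) m] with y hy hys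
  have h1 := hconst _ hy
  have h2 := (hball _ hy).2
  rw [e.left_inv hys] at h1 h2
  rw [show e.symm (e m) = m from extChartAt_to_inv m] at h1
  exact e'.injOn h2 (mem_extChartAt_source (f m)) h1

end Manifold

/-! ### The analytic inverse function theorem -/

section InverseFunction

variable {E : Type*} [NormedAddCommGroup E] [NormedSpace ℝ E] [CompleteSpace E]
  {F : Type*} [NormedAddCommGroup F] [NormedSpace ℝ F]
  {X : Type*} [TopologicalSpace X] [ChartedSpace F X]

/-- The inverse function theorem in the analytic category, phrased with `IsLocalDiffeomorphAt`. -/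
theorem isLocalDiffeomorphAt_of_hasFDerivAt_equiv {f : E → F} {f' : E ≃L[ℝ] F} {a : E}
    (hf : ContDiffAt ℝ ω f a) (hf' : HasFDerivAt f (f' : E →L[ℝ] F) a) :
    IsLocalDiffeomorphAt 𝓘(ℝ, E) 𝓘(ℝ, F) ω f a := by
  have hω : (ω : WithTop ℕ∞) ≠ 0 := by simp
  set H := hf.toOpenPartialHomeomorph f hf' hω with hH
  have hHf : ⇑H = f := hf.toOpenPartialHomeomorph_coe hf' hω
  have haH : a ∈ H.source := hf.mem_toOpenPartialHomeomorph_source hf' hω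
  have hsymm : ContDiffAt ℝ ω H.symm (f a) := hf.to_localInverse hf' hω
  obtain ⟨V, hV, hVo, haV⟩ := eventually_nhds_iff.1 (hf.eventually (by simp))
  obtain ⟨W, hW, hWo, haW⟩ := eventually_nhds_iff.1 (hsymm.eventually (by simp))
  -- Shrink the source so that `f` is analytic on it and the inverse is analytic on its image.
  have hs : IsOpen (V ∩ f ⁻¹' W ∩ H.source) := by
    have := H.isOpen_inter_preimage hWo
    rw [hHf] at this
    rw [inter_assoc, inter_comm (f ⁻¹' W)]
    exact hVo.inter this
  let R := H.restrOpen (V ∩ f ⁻¹' W ∩ H.source) hs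
  refine ⟨⟨R.toPartialEquiv, R.open_source, R.open_target, ?_, ?_⟩, ?_, ?_⟩
  · intro y hy
    have hy' : y ∈ V := by
      have : y ∈ H.source ∩ (V ∩ f ⁻¹' W ∩ H.source) := by simpa [R] using hy
      exact this.2.1.1
    change ContMDiffWithinAt _ _ _ H _ _
    rw [hHf]
    exact (hV y hy').contMDiffAt.contMDiffWithinAt
  · intro z hz
    have h1 : R.symm z ∈ R.source := R.map_target hz
    have h2 : R (R.symm z) = z := R.right_inv hz
    have hz' : z ∈ W := by
      have : R.symm z ∈ H.source ∩ (V ∩ f ⁻¹' W ∩ H.source) := by simpa [R] using h1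
      rw [← h2]
      have h3 := this.2.1.2
      rw [← hHf] at h3
      exact h3
    exact (hW z hz').contMDiffAt.contMDiffWithinAt
  · change a ∈ R.source
    simp only [R, OpenPartialHomeomorph.restrOpen_source]
    exact ⟨haH, ⟨haV, haW⟩, haH⟩
  · intro y _
    change f y = H y
    rw [hHf]

theorem isLocalDiffeomorphAt_chartAt_symm [IsManifold 𝓘(ℝ, F) ω X] (x : X) {y : F}
    (hy : y ∈ (chartAt F x).target) :
    IsLocalDiffeomorphAt 𝓘(ℝ, F) 𝓘(ℝ, F) ω (chartAt F x).symm y :=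
  ⟨⟨(chartAt F x).symm.toPartialEquiv, (chartAt F x).open_target, (chartAt F x).open_source,
    contMDiffOn_chart_symm, contMDiffOn_chart⟩, hy, fun _ _ => rfl⟩

omit [CompleteSpace E] in
theorem _root_.IsLocalDiffeomorphAt.congr_of_eventuallyEq {M : Type*} [TopologicalSpace M]
    [ChartedSpace E M] {f g : M → X} {a : M}
    (hf : IsLocalDiffeomorphAt 𝓘(ℝ, E) 𝓘(ℝ, F) ω f a) (h : g =ᶠ[𝓝 a] f) :
    IsLocalDiffeomorphAt 𝓘(ℝ, E) 𝓘(ℝ, F) ω g a := by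
  obtain ⟨Φ, ha, hΦ⟩ := hf
  obtain ⟨V, hV, hVo, haV⟩ := eventually_nhds_iff.1 h
  let R := Φ.toOpenPartialHomeomorph.restrOpen V hVo
  have hsrc : R.source = Φ.source ∩ V := OpenPartialHomeomorph.restrOpen_source ..
  refine ⟨⟨R.toPartialEquiv, R.open_source, R.open_target,
    Φ.contMDiffOn_toFun.mono (hsrc.subset.trans inter_subset_left),
    Φ.contMDiffOn_invFun.mono fun z hz => ?_⟩, hsrc.symm.subset ⟨ha, haV⟩, fun y hy => ?_⟩
  · have h1 : R.symm z ∈ R.source := R.map_target hz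
    have h2 : R (R.symm z) = z := R.right_inv hz
    rw [← h2]
    exact Φ.map_source (hsrc.subset h1).1
  · exact (hV y (hsrc.subset hy).2).trans (hΦ (hsrc.subset hy).1)

theorem isLocalDiffeomorphAt_of_mfderiv_ne_zero [IsManifold 𝓘(ℝ, F) ω X]
    (hF : Module.finrank ℝ F = 1) {f : ℝ → X} {t : ℝ}
    (hf : ContMDiffAt 𝓘(ℝ, ℝ) 𝓘(ℝ, F) ω f t)
    (h : mfderiv 𝓘(ℝ, ℝ) 𝓘(ℝ, F) f t ≠ 0) :
    IsLocalDiffeomorphAt 𝓘(ℝ, ℝ) 𝓘(ℝ, F) ω f t := by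
  have : FiniteDimensional ℝ F := Module.finite_of_finrank_eq_succ hF
  have hω : (ω : WithTop ℕ∞) ≠ 0 := by simp
  set e := chartAt F (f t) with he
  set g : ℝ → F := fun s => e (f s) with hg
  have hec : ContMDiffAt 𝓘(ℝ, F) 𝓘(ℝ, F) ω e (f t) :=
    contMDiffOn_chart.contMDiffAt (e.open_source.mem_nhds (mem_chart_source F (f t)))
  have hgc : ContDiffAt ℝ ω g t := (hec.comp t hf).contDiffAt
  have hsrc : ∀ᶠ s in 𝓝 t, f s ∈ e.source :=
    hf.continuousAt.preimage_mem_nhds (e.open_source.mem_nhds (mem_chart_source F (f t)))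
  have heq : f =ᶠ[𝓝 t] e.symm ∘ g := by
    filter_upwards [hsrc] with s hs
    simp [hg, e.left_inv hs]
  have hesymm := isLocalDiffeomorphAt_chartAt_symm (F := F) (f t)
    (e.map_source (mem_chart_source F (f t)))
  have hg0 : fderiv ℝ g t ≠ 0 := by
    intro h0
    apply h
    rw [heq.mfderiv_eq, mfderiv_comp t (hesymm.mdifferentiableAt hω)
      (hgc.contMDiffAt.mdifferentiableAt hω), mfderiv_eq_fderiv (f := g), h0]
    exact ContinuousLinearMap.comp_zero _
  have hinj : Function.Injective (fderiv ℝ g t) := by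
    rw [injective_iff_map_eq_zero]
    intro s hs
    by_contra hs0
    apply hg0
    ext
    have : fderiv ℝ g t s = s • fderiv ℝ g t 1 := by rw [← map_smul, smul_eq_mul, mul_one]
    rw [this, smul_eq_zero] at hs
    simpa using hs.resolve_left hs0
  let L : ℝ ≃L[ℝ] F := (LinearEquiv.ofInjectiveOfFinrankEq (fderiv ℝ g t : ℝ →ₗ[ℝ] F) hinj
    (by rw [hF, Module.finrank_self])).toContinuousLinearEquiv
  have hL : HasFDerivAt g (L : ℝ →L[ℝ] F) t := by
    have := (hgc.differentiableAt hω).hasFDerivAt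
    exact this
  exact ((isLocalDiffeomorphAt_of_hasFDerivAt_equiv hgc hL).comp _ _
    hesymm).congr_of_eventuallyEq heq

end InverseFunction

/-! ### Nonconstant analytic maps to a one-dimensional manifold -/

theorem _root_.IsLocalDiffeomorphAt.range_mem_nhds {E F M X : Type*} [NormedAddCommGroup E]
    [NormedSpace ℝ E] [NormedAddCommGroup F] [NormedSpace ℝ F] [TopologicalSpace M]
    [ChartedSpace E M] [TopologicalSpace X] [ChartedSpace F X] {n : WithTop ℕ∞} {f : M → X} {a : M}
    (hf : IsLocalDiffeomorphAt 𝓘(ℝ, E) 𝓘(ℝ, F) n f a) : range f ∈ 𝓝 (f a) := by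
  obtain ⟨Φ, ha, hΦ⟩ := hf
  refine mem_of_superset (Φ.open_target.mem_nhds (hΦ ha ▸ Φ.map_source ha)) fun y hy => ?_
  exact ⟨Φ.symm y, (hΦ (Φ.map_target hy)).trans (Φ.right_inv hy)⟩

section

variable {E : Type*} [NormedAddCommGroup E] [NormedSpace ℝ E]
  {M : Type*} [TopologicalSpace M] [ChartedSpace E M] [IsManifold 𝓘(ℝ, E) ω M]
  {F : Type*} [NormedAddCommGroup F] [NormedSpace ℝ F]
  {X : Type*} [TopologicalSpace X] [ChartedSpace F X] [IsManifold 𝓘(ℝ, F) ω X]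

/-- A nonconstant analytic map from a connected manifold to a one-dimensional manifold has a nonzero
derivative somewhere, so it restricts to a local diffeomorphism along some curve (a straight line in
a chart). -/
theorem exists_curve_isLocalDiffeomorphAt [PreconnectedSpace M] (hF : Module.finrank ℝ F = 1)
    {f : M → X} (hf : ContMDiff 𝓘(ℝ, E) 𝓘(ℝ, F) ω f) {a b : M} (hab : f a ≠ f b) :
    ∃ c : ℝ → M, ContMDiffAt 𝓘(ℝ, ℝ) 𝓘(ℝ, E) ω c 0 ∧
      IsLocalDiffeomorphAt 𝓘(ℝ, ℝ) 𝓘(ℝ, F) ω (fun s => f (c s)) 0 := by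
  have hω : (ω : WithTop ℕ∞) ≠ 0 := by simp
  have : IsManifold 𝓘(ℝ, E) 1 M := IsManifold.of_le (n := ω) le_top
  have : IsManifold 𝓘(ℝ, F) 1 X := IsManifold.of_le (n := ω) le_top
  obtain ⟨m, hm⟩ : ∃ m, mfderiv 𝓘(ℝ, E) 𝓘(ℝ, F) f m ≠ 0 := by
    by_contra! h0
    exact hab ((isLocallyConstant_of_mfderiv_eq_zero
      (hf.mdifferentiable hω) h0).apply_eq_of_preconnectedSpace a b)
  set e := extChartAt 𝓘(ℝ, E) m with he
  have hem : e.symm (e m) = m := extChartAt_to_inv m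
  have hes : ContMDiffAt 𝓘(ℝ, E) 𝓘(ℝ, E) ω e.symm (e m) :=
    (contMDiffOn_extChartAt_symm m).contMDiffAt (extChartAt_target_mem_nhds m)
  have hg : ContMDiffAt 𝓘(ℝ, E) 𝓘(ℝ, F) ω (fun y => f (e.symm y)) (e m) :=
    (hf _).comp (e m) hes
  have hec : ContMDiffAt 𝓘(ℝ, E) 𝓘(ℝ, E) ω e m := contMDiffAt_extChartAt
  have hg0 : mfderiv 𝓘(ℝ, E) 𝓘(ℝ, F) (fun y => f (e.symm y)) (e m) ≠ 0 := by
    intro h0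
    apply hm
    have heq : f =ᶠ[𝓝 m] (fun y => f (e.symm y)) ∘ e := by
      filter_upwards [extChartAt_source_mem_nhds (I := 𝓘(ℝ, E)) m] with y hy
      simp only [Function.comp_apply, e.left_inv hy]
    have h1 := (hg.mdifferentiableAt hω).hasMFDerivAt.comp m (hec.mdifferentiableAt hω).hasMFDerivAt
    rw [h0] at h1
    have h2 := (h1.congr_of_eventuallyEq heq).mfderiv
    rw [h2]
    exact ContinuousLinearMap.zero_comp _
  obtain ⟨v, hv⟩ : ∃ v : E, mfderiv 𝓘(ℝ, E) 𝓘(ℝ, F) (fun y => f (e.symm y)) (e m) v ≠ 0 := by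
    by_contra! h
    exact hg0 (ContinuousLinearMap.ext h)
  have hline : ContDiff ℝ ω (fun s : ℝ => e m + s • v) := by fun_prop
  have hl0 : e m + (0 : ℝ) • v = e m := by simp
  have hcc : ContMDiffAt 𝓘(ℝ, ℝ) 𝓘(ℝ, E) ω (fun s : ℝ => e.symm (e m + s • v)) 0 :=
    ContMDiffAt.comp (g := e.symm) (0 : ℝ) (by rw [hl0]; exact hes) hline.contMDiff.contMDiffAt
  refine ⟨fun s => e.symm (e m + s • v), hcc, ?_⟩
  refine isLocalDiffeomorphAt_of_mfderiv_ne_zero hF ((hf _).comp (0 : ℝ) hcc) fun h0 => hv ?_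
  have hld : HasFDerivAt (fun s : ℝ => e m + s • v)
      (ContinuousLinearMap.toSpanSingleton ℝ v) 0 :=
    (((hasDerivAt_id (0 : ℝ)).smul_const v).const_add (e m)).hasFDerivAt.congr_fderiv
      (by ext; simp)
  have h1 : HasMFDerivAt 𝓘(ℝ, E) 𝓘(ℝ, F) (fun y => f (e.symm y)) (e m + (0 : ℝ) • v)
      (mfderiv 𝓘(ℝ, E) 𝓘(ℝ, F) (fun y => f (e.symm y)) (e m + (0 : ℝ) • v)) :=
    MDifferentiableAt.hasMFDerivAt (by rw [hl0]; exact hg.mdifferentiableAt hω)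
  have h2 := (h1.comp (0 : ℝ) hld.hasMFDerivAt).mfderiv
  have h3 : mfderiv 𝓘(ℝ, E) 𝓘(ℝ, F) (fun y => f (e.symm y)) (e m + (0 : ℝ) • v) ((1 : ℝ) • v) = 0 :=
    congrArg (fun L : ℝ →L[ℝ] F => L 1) (h2.symm.trans h0)
  rwa [one_smul, hl0] at h3

theorem range_mem_nhds_of_ne [PreconnectedSpace M] (hF : Module.finrank ℝ F = 1)
    {f : M → X} (hf : ContMDiff 𝓘(ℝ, E) 𝓘(ℝ, F) ω f) {a b : M} (hab : f a ≠ f b) :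
    ∃ m, range f ∈ 𝓝 (f m) := by
  obtain ⟨c, -, hc⟩ := exists_curve_isLocalDiffeomorphAt hF hf hab
  exact ⟨c 0, mem_of_superset hc.range_mem_nhds (range_comp_subset_range c f)⟩

end

/-! ### Transitivity and commutativity of nilpotent actions -/

section Action

variable {E : Type*} [NormedAddCommGroup E] [NormedSpace ℝ E]
  {N : Type*} [TopologicalSpace N] [ChartedSpace E N] [Group N]
  [LieGroup 𝓘(ℝ, E) ω N]
  {F : Type*} [NormedAddCommGroup F] [NormedSpace ℝ F]
  {X : Type*} [TopologicalSpace X] [ChartedSpace F X] [IsManifold 𝓘(ℝ, F) ω X]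
  [MulAction N X] [ContMDiffSMul 𝓘(ℝ, E) 𝓘(ℝ, F) ω N X]

variable [PreconnectedSpace N] [PreconnectedSpace X]

variable (E) in
include E in
/-- Without common fixed points, every orbit map is nonconstant, so every orbit has an interior
point. -/
theorem isPretransitive_of_no_fixedPoint (hF : Module.finrank ℝ F = 1)
    (hfix : ¬ ∃ x : X, ∀ n : N, n • x = x) : MulAction.IsPretransitive N X := by
  have : ContinuousSMul N X :=
    ContMDiffSMul.continuousSMul (I := 𝓘(ℝ, E)) (I' := 𝓘(ℝ, F)) ω
  refine isPretransitive_of_orbit_mem_nhds fun x => ?_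
  push Not at hfix
  obtain ⟨n, hn⟩ := hfix x
  have horbit : ContMDiff 𝓘(ℝ, E) 𝓘(ℝ, F) ω (fun n : N => n • x) :=
    contMDiff_id.smul (I := 𝓘(ℝ, E)) contMDiff_const
  obtain ⟨m, hm⟩ := range_mem_nhds_of_ne hF horbit (a := n) (b := 1) (by simpa using hn)
  exact ⟨m • x, MulAction.mem_orbit x m, hm⟩

variable (E) in
include E in
/-- A transitive nilpotent action on a one-dimensional manifold is commutative. The criterion
`smul_smul_comm_of_isNilpotent` applies: if `⁅c, n⁆` moves `x₀`, then `m ↦ (g * ⁅c, m⁆) • x₀` is a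
nonconstant analytic map from the connected group `N`, so its image has an interior point. -/
theorem smul_smul_comm_of_isPretransitive [Group.IsNilpotent N] [MulAction.IsPretransitive N X]
    (hF : Module.finrank ℝ F = 1) (a b : N) (x : X) : a • b • x = b • a • x := by
  have : ContinuousSMul N X :=
    ContMDiffSMul.continuousSMul (I := 𝓘(ℝ, E)) (I' := 𝓘(ℝ, F)) ω
  refine smul_smul_comm_of_isNilpotent (fun k c n x₀ hc hne => ?_) a b x
  set S := (⊤ : Subgroup N).lowerCentralSeries (k + 1)
  suffices MulAction.IsPretransitive S X by
    intro x y
    obtain ⟨g, hg⟩ := MulAction.exists_smul_eq S x y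
    exact ⟨g, g.2, hg⟩
  refine isPretransitive_of_orbit_mem_nhds fun x => ?_
  obtain ⟨g, rfl⟩ := MulAction.exists_smul_eq N x₀ x
  -- `(g * ⁅c, m⁆) • x₀` lies in the orbit of `g • x₀` under `S`, as `S` is normal.
  have hcomm : ∀ m : N, g * ⁅c, m⁆ * g⁻¹ ∈ S := fun m =>
    Subgroup.Normal.conj_mem inferInstance _
      (Subgroup.commutator_mem_commutator hc (Subgroup.mem_top m)) g
  have hsmul : ∀ m : N, (⟨_, hcomm m⟩ : S) • g • x₀ = (g * ⁅c, m⁆) • x₀ := fun m => by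
    simp [Subgroup.smul_def, smul_smul]
  have hinv : ContMDiff 𝓘(ℝ, E) 𝓘(ℝ, E) ω fun m : N => m⁻¹ := contMDiff_inv _ _
  have hf : ContMDiff 𝓘(ℝ, E) 𝓘(ℝ, F) ω (fun m : N => (g * ⁅c, m⁆) • x₀) := by
    refine ContMDiff.smul (I := 𝓘(ℝ, E)) ?_ contMDiff_const
    simp only [commutatorElement_def]
    exact contMDiff_const.mul (((contMDiff_const.mul contMDiff_id).mul contMDiff_const).mul hinv)
  obtain ⟨m, hm⟩ := range_mem_nhds_of_ne hF hf (a := n) (b := 1) (by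
    simpa [mul_smul] using hne)
  refine ⟨(g * ⁅c, m⁆) • x₀, ⟨_, hsmul m⟩, mem_of_superset hm ?_⟩
  rintro _ ⟨m', rfl⟩
  exact ⟨_, hsmul m'⟩

end Action

/-! ### The unit speed coordinate -/

section OneParameter

variable {E : Type*} [NormedAddCommGroup E] [NormedSpace ℝ E]
  {N : Type*} [TopologicalSpace N] [ChartedSpace E N] [Group N] [LieGroup 𝓘(ℝ, E) ω N]
  {F : Type*} [NormedAddCommGroup F] [NormedSpace ℝ F]
  {X : Type*} [TopologicalSpace X] [ChartedSpace F X] [IsManifold 𝓘(ℝ, F) ω X]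
  [MulAction N X] [ContMDiffSMul 𝓘(ℝ, E) 𝓘(ℝ, F) ω N X]

include E in
/-- A curve `c` in the group, through `1`, which moves some point with nonzero speed, together with
a local coordinate of `X` in which the velocity field of `c` is constant equal to `1`. The
coordinate is obtained by integrating the reciprocal of the velocity field. -/
theorem exists_unit_speed_parametrization [PreconnectedSpace N] (hF : Module.finrank ℝ F = 1)
    {x₀ : X} {n₀ : N} (hn₀ : n₀ • x₀ ≠ x₀) :
    ∃ (c : ℝ → N) (e : PartialDiffeomorph 𝓘(ℝ, ℝ) 𝓘(ℝ, F) ℝ X ω) (δ : ℝ),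
      0 < δ ∧ c 0 = 1 ∧ ContinuousAt c 0 ∧ Metric.ball 0 δ ⊆ e.source ∧
      ∀ τ ∈ Metric.ball 0 δ, HasDerivAt (fun s => e.symm (c s • e τ)) 1 0 := by
  have hω : (ω : WithTop ℕ∞) ≠ 0 := by simp
  have : ContinuousSMul N X :=
    ContMDiffSMul.continuousSMul (I := 𝓘(ℝ, E)) (I' := 𝓘(ℝ, F)) ω
  have horbit : ContMDiff 𝓘(ℝ, E) 𝓘(ℝ, F) ω (fun n : N => n • x₀) :=
    contMDiff_id.smul (I := 𝓘(ℝ, E)) contMDiff_const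
  obtain ⟨c₀, hc₀, Φ, hΦ0, hΦ⟩ := exists_curve_isLocalDiffeomorphAt hF horbit (a := n₀) (b := 1)
    (by simpa using hn₀)
  -- Translate the curve to the identity; its base point moves to `c₀ 0 • x₀ = Φ 0`.
  set c : ℝ → N := fun s => c₀ s * (c₀ 0)⁻¹ with hc
  have hc0 : c 0 = 1 := by simp [hc]
  have hcc : ContMDiffAt 𝓘(ℝ, ℝ) 𝓘(ℝ, E) ω c 0 := hc₀.mul contMDiffAt_const
  have hcΦ : ∀ s ∈ Φ.source, c s • Φ 0 = Φ s := by
    intro s hs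
    rw [← hΦ hs, ← hΦ hΦ0]
    simp [hc, mul_smul]
  -- In the coordinate `Φ.symm`, the function `Z` below is the velocity field of the curve `c`.
  let A : ℝ × ℝ → ℝ := fun p => Φ.symm (c p.2 • Φ p.1)
  have hA : ContDiffAt ℝ ω A (0, 0) := by
    rw [← contMDiffAt_iff_contDiffAt]
    have h1 : ContMDiffAt 𝓘(ℝ, ℝ × ℝ) 𝓘(ℝ, E) ω (fun p : ℝ × ℝ => c p.2) (0, 0) :=
      ContMDiffAt.comp (g := c) ((0, 0) : ℝ × ℝ) hcc contDiff_snd.contMDiff.contMDiffAt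
    have h2 : ContMDiffAt 𝓘(ℝ, ℝ × ℝ) 𝓘(ℝ, F) ω (fun p : ℝ × ℝ => Φ p.1) (0, 0) :=
      ContMDiffAt.comp (g := Φ) ((0, 0) : ℝ × ℝ)
        (Φ.contMDiffOn.contMDiffAt (Φ.open_source.mem_nhds hΦ0)) contDiff_fst.contMDiff.contMDiffAt
    refine ContMDiffAt.comp (g := Φ.symm) ((0, 0) : ℝ × ℝ) ?_ (h1.smul (I := 𝓘(ℝ, E)) h2)
    refine Φ.symm.contMDiffOn.contMDiffAt (Φ.open_target.mem_nhds ?_)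
    change c 0 • Φ 0 ∈ Φ.target
    rw [hc0, one_smul]
    exact Φ.map_source hΦ0
  let Z : ℝ → ℝ := fun t => fderiv ℝ A (t, 0) (0, 1)
  have hZ : ContDiffAt ℝ ω Z 0 :=
    (ContDiffAt.comp (g := fderiv ℝ A) (f := fun t : ℝ => (t, (0 : ℝ))) (0 : ℝ)
      (hA.fderiv_right (m := ω) (by simp))
      (contDiffAt_id.prodMk contDiffAt_const)).clm_apply contDiffAt_const
  have hAZ : ∀ᶠ t in 𝓝 (0 : ℝ), HasDerivAt (fun s => A (t, s)) (Z t) 0 := by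
    have h1 : ∀ᶠ p in 𝓝 ((0, 0) : ℝ × ℝ), ContDiffAt ℝ ω A p := hA.eventually (by simp)
    have h2 : Tendsto (fun t : ℝ => (t, (0 : ℝ))) (𝓝 0) (𝓝 (0, 0)) :=
      (Continuous.prodMk_left (0 : ℝ)).tendsto' _ _ rfl
    filter_upwards [h2.eventually h1] with t ht
    have := (ht.differentiableAt hω).hasFDerivAt.comp_hasDerivAt (0 : ℝ)
      ((hasDerivAt_const (0 : ℝ) t).prodMk (hasDerivAt_id (0 : ℝ)))
    exact this
  have hZ0 : Z 0 = 1 := by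
    refine hAZ.self_of_nhds.unique ((hasDerivAt_id (0 : ℝ)).congr_of_eventuallyEq ?_)
    filter_upwards [Φ.open_source.mem_nhds hΦ0] with s hs
    change Φ.symm (c s • Φ 0) = s
    rw [hcΦ s hs]
    exact Φ.left_inv hs
  have hinv : ContDiffAt ℝ ω (fun t => (Z t)⁻¹) 0 := hZ.inv (by rw [hZ0]; exact one_ne_zero)
  -- In the coordinate `u` with `du = dt / Z`, the velocity field becomes constant.
  obtain ⟨u, hu, hu0, hu'⟩ := exists_analyticAt_primitive (hinv.analyticAt)
  have hud : IsLocalDiffeomorphAt 𝓘(ℝ, ℝ) 𝓘(ℝ, ℝ) ω u 0 := by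
    refine isLocalDiffeomorphAt_of_mfderiv_ne_zero (Module.finrank_self ℝ)
      hu.contDiffAt.contMDiffAt fun h0 => ?_
    have h1 := hu'.self_of_nhds.deriv
    rw [hZ0, inv_one, ← fderiv_apply_one_eq_deriv, ← mfderiv_eq_fderiv, h0] at h1
    have h2 : (0 : ℝ) = 1 := h1
    exact zero_ne_one h2
  obtain ⟨V, hV0, hV⟩ := hud
  have hVu : V 0 = 0 := by rw [← hV hV0, hu0]
  have h0V : (0 : ℝ) ∈ V.target := hVu ▸ V.map_source hV0
  have hVs0 : V.symm 0 = 0 := by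
    have := V.left_inv hV0
    rw [hVu] at this
    exact this
  have hVcont : Tendsto V.symm (𝓝 0) (𝓝 0) := by
    have := (V.symm.contMDiffOn.contMDiffAt (V.open_target.mem_nhds h0V)).continuousAt.tendsto
    rwa [hVs0] at this
  have hZne : ∀ᶠ t in 𝓝 (0 : ℝ), Z t ≠ 0 :=
    hZ.continuousAt.eventually_ne (by rw [hZ0]; exact one_ne_zero)
  obtain ⟨δ, hδ, hball⟩ := Metric.eventually_nhds_iff_ball.1 <|
    (V.open_target.eventually_mem h0V).and <|
      hVcont.eventually ((Φ.open_source.eventually_mem hΦ0).and (hu'.and (hAZ.and hZne)))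
  refine ⟨c, V.symm.trans Φ, δ, hδ, hc0, hcc.continuousAt, fun τ hτ => ?_, fun τ hτ => ?_⟩
  · exact ⟨(hball τ hτ).1, (hball τ hτ).2.1⟩
  · obtain ⟨h1, h2, h3, h4, h5⟩ := hball τ hτ
    set t := V.symm τ with ht
    have hAt : A (t, 0) = t := by
      change Φ.symm (c 0 • Φ t) = t
      rw [hc0, one_smul]
      exact Φ.left_inv h2
    have hcomp : HasDerivAt (fun s => u (A (t, s))) ((Z t)⁻¹ * Z t) 0 :=
      HasDerivAt.comp (h₂ := u) (0 : ℝ) (by rw [hAt]; exact h3) h4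
    rw [inv_mul_cancel₀ h5] at hcomp
    refine hcomp.congr_of_eventuallyEq ?_
    have htV : t ∈ V.source := V.map_target h1
    have hcont : ∀ᶠ s in 𝓝 (0 : ℝ), A (t, s) ∈ V.source :=
      h4.continuousAt.eventually (by simp only [hAt]; exact V.open_source.eventually_mem htV)
    filter_upwards [hcont] with s hs
    exact (hV hs).symm

variable [T2Space X] (hcomm : ∀ (a b : N) (x : X), a • b • x = b • a • x)
  {c : ℝ → N} {e : PartialDiffeomorph 𝓘(ℝ, ℝ) 𝓘(ℝ, F) ℝ X ω} {δ : ℝ}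
  (hc0 : c 0 = 1) (hc : ContinuousAt c 0) (he : Metric.ball 0 δ ⊆ e.source)
  (hder : ∀ τ ∈ Metric.ball 0 δ, HasDerivAt (fun s => e.symm (c s • e τ)) 1 0)

include E hcomm hc0 hc he hder

omit [LieGroup 𝓘(ℝ, E) ω N] [T2Space X] [IsManifold 𝓘(ℝ, F) ω X] in
/-- An element of `N` commutes with the curve `c`, so it preserves the velocity field of `c`; in the
unit speed coordinate its derivative is therefore `1`. -/
theorem hasDerivAt_smul_parametrization {n : N} {τ τ' : ℝ} (hτ : τ ∈ Metric.ball 0 δ)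
    (hτ' : τ' ∈ Metric.ball 0 δ) (hn : n • e τ = e τ') :
    HasDerivAt (fun s => e.symm (n • e s)) 1 τ := by
  have hω : (ω : WithTop ℕ∞) ≠ 0 := by simp
  have : ContinuousSMul N X :=
    ContMDiffSMul.continuousSMul (I := 𝓘(ℝ, E)) (I' := 𝓘(ℝ, F)) ω
  have hβ : ContMDiffAt 𝓘(ℝ, ℝ) 𝓘(ℝ, ℝ) ω (fun s => e.symm (n • e s)) τ := by
    refine ContMDiffAt.comp (g := e.symm) τ (e.symm.contMDiffOn.contMDiffAt
      (e.open_target.mem_nhds (hn ▸ e.map_source (he hτ')))) ?_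
    exact (ContMDiffSMul.contMDiff_const_smul (I := 𝓘(ℝ, E)) n).contMDiffAt.comp τ
      (e.contMDiffOn.contMDiffAt (e.open_source.mem_nhds (he hτ)))
  have hd := (hβ.contDiffAt.differentiableAt hω).hasDerivAt
  set b := deriv (fun s => e.symm (n • e s)) τ
  have hγ0 : e.symm (c 0 • e τ) = τ := by
    rw [hc0, one_smul]
    exact e.left_inv (he hτ)
  have h1 : HasDerivAt (fun s => e.symm (n • e (e.symm (c s • e τ)))) (b * 1) 0 :=
    HasDerivAt.comp (h₂ := fun s => e.symm (n • e s)) (0 : ℝ) (by rw [hγ0]; exact hd) (hder τ hτ)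
  have hcont : ContinuousAt (fun s => c s • e τ) 0 := hc.smul continuousAt_const
  have htarget : ∀ᶠ s in 𝓝 (0 : ℝ), c s • e τ ∈ e.target :=
    hcont.eventually (e.open_target.eventually_mem (by
      simp only [hc0, one_smul]; exact e.map_source (he hτ)))
  -- By commutativity, `n • c s • e τ = c s • e τ'`, whose coordinate has speed `1` as well.
  have h2 : HasDerivAt (fun s => e.symm (n • e (e.symm (c s • e τ)))) 1 0 := by
    refine (hder τ' hτ').congr_of_eventuallyEq ?_
    filter_upwards [htarget] with s hs
    have : e (e.symm (c s • e τ)) = c s • e τ := e.right_inv hs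
    rw [this, hcomm, hn]
  have hb := h1.unique h2
  rw [mul_one] at hb
  rwa [hb] at hd

omit [LieGroup 𝓘(ℝ, E) ω N] [T2Space X] [IsManifold 𝓘(ℝ, F) ω X] in
/-- In the unit speed coordinate, each element of `N` is locally a translation. -/
theorem eventually_smul_parametrization {n : N} {τ τ' : ℝ} (hτ : τ ∈ Metric.ball 0 δ)
    (hτ' : τ' ∈ Metric.ball 0 δ) (hn : n • e τ = e τ') :
    ∀ᶠ s in 𝓝 τ, n • e s = e (τ' + (s - τ)) := by
  have hβ := hasDerivAt_smul_parametrization (E := E) hcomm hc0 hc he hder hτ hτ' hn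
  have : ContinuousSMul N X :=
    ContMDiffSMul.continuousSMul (I := 𝓘(ℝ, E)) (I' := 𝓘(ℝ, F)) ω
  have hβτ : e.symm (n • e τ) = τ' := by rw [hn]; exact e.left_inv (he hτ')
  have hcont : ContinuousAt (fun s => n • e s) τ :=
    (e.contMDiffOn.contMDiffAt (e.open_source.mem_nhds (he hτ))).continuousAt.const_smul n
  obtain ⟨r, hr, hball⟩ := Metric.eventually_nhds_iff_ball.1 <|
    (Metric.isOpen_ball.eventually_mem hτ).and <|
      (hβ.continuousAt.eventually (p := fun y => y ∈ Metric.ball 0 δ)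
        (by simp only [hβτ]; exact Metric.isOpen_ball.eventually_mem hτ')).and <|
        hcont.eventually (e.open_target.eventually_mem
          (by simp only [hn]; exact e.map_source (he hτ')))
  have heq : ∀ s ∈ Metric.ball τ r, e (e.symm (n • e s)) = n • e s :=
    fun s hs => e.right_inv (hball s hs).2.2
  have hone : ∀ s ∈ Metric.ball τ r, HasDerivAt (fun s => e.symm (n • e s)) 1 s := fun s hs =>
    hasDerivAt_smul_parametrization (E := E) hcomm hc0 hc he hder (hball s hs).1 (hball s hs).2.1
      (heq s hs).symm
  have hconst : ∀ s ∈ Metric.ball τ r, e.symm (n • e s) - s = e.symm (n • e τ) - τ := by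
    intro s hs
    have hd : ∀ z ∈ Metric.ball τ r,
        HasDerivAt (fun s => e.symm (n • e s) - s) 0 z := fun z hz => by
      have := (hone z hz).fun_sub (hasDerivAt_id z)
      rwa [sub_self] at this
    exact Metric.isOpen_ball.is_const_of_deriv_eq_zero (convex_ball τ r).isPreconnected
      (fun z hz => (hd z hz).differentiableAt.differentiableWithinAt)
      (fun z hz => (hd z hz).deriv) hs (Metric.mem_ball_self hr)
  filter_upwards [Metric.ball_mem_nhds τ hr] with s hs
  rw [← heq s hs]
  congr 1
  linarith [hconst s hs]

omit [LieGroup 𝓘(ℝ, E) ω N] [IsManifold 𝓘(ℝ, F) ω X] in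
/-- An element of `N` taking the coordinate `0` to `σ` acts as the translation by `σ` on the whole
interval `|τ| < δ / 2`. The set where this holds is open by the local statement, and relatively
closed by continuity. -/
theorem smul_parametrization_eq_add {n : N} {σ τ : ℝ} (hσ : |σ| < δ / 2) (hτ : |τ| < δ / 2)
    (hn : n • e 0 = e σ) : n • e τ = e (σ + τ) := by
  have : ContinuousSMul N X :=
    ContMDiffSMul.continuousSMul (I := 𝓘(ℝ, E)) (I' := 𝓘(ℝ, F)) ω
  have hmem : ∀ s : ℝ, |s| < δ / 2 → s ∈ Metric.ball 0 δ ∧ σ + s ∈ Metric.ball 0 δ := by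
    intro s hs
    simp only [mem_ball_zero_iff, Real.norm_eq_abs]
    have := abs_add_le σ s
    have := abs_nonneg s
    constructor <;> linarith
  have hball : ∀ s : ℝ, s ∈ Metric.ball 0 (δ / 2) ↔ |s| < δ / 2 := fun s => by
    simp
  have hecont : ∀ s ∈ Metric.ball 0 δ, ContinuousAt e s := fun s hs =>
    (e.contMDiffOn.contMDiffAt (e.open_source.mem_nhds (he hs))).continuousAt
  let U : Set ℝ := {s | |s| < δ / 2 ∧ n • e s = e (σ + s)}
  have hU : IsOpen U := by
    rw [isOpen_iff_mem_nhds]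
    rintro s ⟨hs, hns⟩
    filter_upwards [Metric.isOpen_ball.mem_nhds ((hball s).2 hs),
      eventually_smul_parametrization (E := E) hcomm hc0 hc he hder (hmem s hs).1 (hmem s hs).2 hns]
      with z hz hz'
    refine ⟨(hball z).1 hz, hz'.trans ?_⟩
    congr 1
    ring
  have h0 : (0 : ℝ) ∈ U := ⟨by rw [abs_zero]; exact (abs_nonneg σ).trans_lt hσ, by simpa using hn⟩
  have hclosed : closure U ∩ Metric.ball 0 (δ / 2) ⊆ U := by
    rintro s ⟨hs, hsb⟩
    have hs' := (hball s).1 hsb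
    refine ⟨hs', ?_⟩
    have h1 : Tendsto (fun z => n • e z) (𝓝 s) (𝓝 (n • e s)) :=
      (hecont s (hmem s hs').1).const_smul n
    have h2 : Tendsto (fun z => e (σ + z)) (𝓝 s) (𝓝 (e (σ + s))) :=
      ContinuousAt.comp (g := e) (hecont _ (hmem s hs').2) (continuous_const_add σ).continuousAt
    exact tendsto_nhds_unique_of_frequently_eq h1 h2
      ((mem_closure_iff_frequently.1 hs).mono fun z hz => hz.2)
  have := (convex_ball (0 : ℝ) (δ / 2)).isPreconnected.subset_of_closure_inter_subset hU
    ⟨0, (hball 0).2 h0.1, h0⟩ hclosed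
  exact (this ((hball τ).2 hτ)).2

end OneParameter

/-! ### The developing map -/

section Developing

variable {E : Type*} [NormedAddCommGroup E] [NormedSpace ℝ E]
  {N : Type*} [TopologicalSpace N] [ChartedSpace E N] [Group N] [LieGroup 𝓘(ℝ, E) ω N]
  {F : Type*} [NormedAddCommGroup F] [NormedSpace ℝ F]
  {X : Type*} [TopologicalSpace X] [ChartedSpace F X] [IsManifold 𝓘(ℝ, F) ω X]
  [MulAction N X] [ContMDiffSMul 𝓘(ℝ, E) 𝓘(ℝ, F) ω N X]

theorem isLocalDiffeomorphAt_affine {a : ℝ} (ha : a ≠ 0) (b t : ℝ) :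
    IsLocalDiffeomorphAt 𝓘(ℝ, ℝ) 𝓘(ℝ, ℝ) ω (fun s => a * s + b) t := by
  refine isLocalDiffeomorphAt_of_hasFDerivAt_equiv
    (f' := ContinuousLinearEquiv.unitsEquivAut ℝ (Units.mk0 a ha)) (by fun_prop) ?_
  exact (((hasDerivAt_id t).const_mul a).add_const b).hasFDerivAt.congr_fderiv (by ext; simp)

variable (E) in
include E in
/-- The developing map: an analytic local diffeomorphism of `ℝ` onto `X`, for which the
transformations of `N` correspond exactly to translations of `ℝ`. -/
theorem exists_equivariant_isLocalDiffeomorph [PreconnectedSpace N] [PreconnectedSpace X]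
    [T2Space X] [MulAction.IsPretransitive N X] (hF : Module.finrank ℝ F = 1)
    (hcomm : ∀ (a b : N) (x : X), a • b • x = b • a • x)
    {x₀ : X} {n₀ : N} (hn₀ : n₀ • x₀ ≠ x₀) :
    ∃ φ : ℝ → X, IsLocalDiffeomorph 𝓘(ℝ, ℝ) 𝓘(ℝ, F) ω φ ∧ Function.Surjective φ ∧
      (∀ n : N, ∃ t, ∀ s, n • φ s = φ (t + s)) ∧ ∀ t, ∃ n : N, ∀ s, n • φ s = φ (t + s) := by
  have : ContinuousSMul N X :=
    ContMDiffSMul.continuousSMul (I := 𝓘(ℝ, E)) (I' := 𝓘(ℝ, F)) ω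
  obtain ⟨c, e, δ, hδ, hc0, hc, he, hder⟩ :=
    exists_unit_speed_parametrization (E := E) (F := F) hF hn₀
  -- A transformation of a transitive commutative action is determined by the image of one point.
  have hfree : ∀ {a b : N} {x : X}, a • x = b • x → ∀ y : X, a • y = b • y := by
    intro a b x hab y
    obtain ⟨g, rfl⟩ := MulAction.exists_smul_eq N x y
    rw [hcomm, hab, hcomm]
  choose n hn using fun s : ℝ => MulAction.exists_smul_eq N (e 0) (e s)
  -- In the group of transformations, the translations of the unit speed coordinate form a local
  -- one-parameter group, which extends to all of `ℝ`.
  let q := (MulAction.toPermHom N X).rangeRestrict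
  obtain ⟨Ψ, hΨ⟩ := exists_monoidHom_eq_of_local_add (half_pos hδ) (fun s => q (n s)) (by
    intro s t hs ht _
    rw [← map_mul]
    refine Subtype.ext (Equiv.ext fun y => ?_)
    refine hfree (x := e 0) ?_ y
    rw [hn, mul_smul, hn, smul_parametrization_eq_add (E := E) hcomm hc0 hc he hder hs ht (hn s)])
  have hΨn : ∀ t : ℝ, ∃ m : N, ∀ x : X, (Ψ (.ofAdd t) : Equiv.Perm X) x = m • x := by
    intro t
    obtain ⟨m, hm⟩ := (Ψ (.ofAdd t)).2
    exact ⟨m, fun x => by rw [← hm]; rfl⟩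
  let φ : ℝ → X := fun t => (Ψ (.ofAdd t) : Equiv.Perm X) (e 0)
  have hφadd : ∀ s t, φ (s + t) = (Ψ (.ofAdd s) : Equiv.Perm X) (φ t) := fun s t => by
    simp [φ, ofAdd_add]
  have hφe : ∀ t, |t| < δ / 2 → φ t = e t := by
    intro t ht
    simp only [φ, hΨ t ht]
    exact hn t
  have hφnat : ∀ (m : N) (t : ℝ), m • φ t = (Ψ (.ofAdd t) : Equiv.Perm X) (m • e 0) := by
    intro m t
    obtain ⟨k, hk⟩ := hΨn t
    simp only [φ, hk]
    exact hcomm _ _ _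
  have hloc : IsLocalDiffeomorph 𝓘(ℝ, ℝ) 𝓘(ℝ, F) ω φ := by
    intro t₀
    obtain ⟨m, hm⟩ := hΨn t₀
    have h0 : (0 : ℝ) ∈ e.source := he (Metric.mem_ball_self hδ)
    have h1 := isLocalDiffeomorphAt_affine one_ne_zero (-t₀) t₀
    have h2 : IsLocalDiffeomorphAt 𝓘(ℝ, ℝ) 𝓘(ℝ, F) ω e (1 * t₀ + -t₀) := by
      simpa using e.isLocalDiffeomorphAt _ _ _ h0
    have h3 := (Diffeomorph.smul 𝓘(ℝ, E) 𝓘(ℝ, F) ω m (M := X)).isLocalDiffeomorph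
      (e (1 * t₀ + -t₀))
    refine ((h1.comp _ _ h2).comp _ _ h3).congr_of_eventuallyEq ?_
    filter_upwards [Metric.ball_mem_nhds t₀ (half_pos hδ)] with t ht
    rw [Metric.mem_ball, Real.dist_eq] at ht
    have : φ t = m • e (t - t₀) := by
      rw [← hφe _ ht, ← hm, ← hφadd]
      simp
    rw [this]
    simp [sub_eq_add_neg]
  -- The range of `φ` is an orbit of the one-parameter group. It is open, and its translates by `N`
  -- are either equal to it or disjoint from it, so it is closed too.
  have hsurj : Function.Surjective φ := by
    rw [← range_eq_univ]
    refine IsClopen.eq_univ ⟨?_, hloc.isOpen_range⟩ ⟨φ 0, 0, rfl⟩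
    rw [← isOpen_compl_iff, isOpen_iff_mem_nhds]
    intro y hy
    obtain ⟨m, rfl⟩ := MulAction.exists_smul_eq N (φ 0) y
    have hmem := (smul_mem_nhds_smul_iff m).2 (hloc.isOpen_range.mem_nhds ⟨0, rfl⟩)
    refine mem_of_superset hmem ?_
    rintro _ ⟨_, ⟨s, rfl⟩, rfl⟩ ⟨t, ht⟩
    -- If `m • φ s = φ t`, then `m • φ 0 = φ (t - s)`.
    refine hy ⟨-s + t, ?_⟩
    rw [hφadd, ht]
    obtain ⟨k, hk⟩ := hΨn (-s)
    simp only [hk]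
    rw [hcomm, ← hk, ← hφadd, neg_add_cancel]
  refine ⟨φ, hloc, hsurj, fun m => ?_, fun t => ?_⟩
  rotate_left
  · obtain ⟨k, hk⟩ := hΨn t
    exact ⟨k, fun s => by rw [hφadd, hk]⟩
  obtain ⟨t, ht⟩ := hsurj (m • φ 0)
  refine ⟨t, fun s => ?_⟩
  have : φ 0 = e 0 := hφe 0 (by simpa using half_pos hδ)
  rw [hφnat, ← this, ← ht, ← hφadd, add_comm]

end Developing

/-! ### The fibres of the developing map -/

/-- The periods of `φ` form a subgroup of `ℝ`, which is not dense because `φ` is locally injective;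
hence it is cyclic. -/
theorem injective_or_periodic {F : Type*} [NormedAddCommGroup F] [NormedSpace ℝ F]
    {X : Type*} [TopologicalSpace X] [ChartedSpace F X] {φ : ℝ → X}
    (hloc : IsLocalDiffeomorphAt 𝓘(ℝ, ℝ) 𝓘(ℝ, F) ω φ 0)
    (htrans : ∀ r s t, φ s = φ t → φ (r + s) = φ (r + t)) :
    Function.Injective φ ∨ ∃ a : ℝ, a ≠ 0 ∧ ∀ s t, φ s = φ t ↔ ∃ k : ℤ, s = t + k * a := by
  let K : AddSubgroup ℝ :=
    { carrier := {t | φ t = φ 0}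
      zero_mem' := rfl
      add_mem' := fun {s t} hs ht => by
        have := htrans s t 0 ht
        rw [add_zero] at this
        exact this.trans hs
      neg_mem' := fun {t} ht => by
        have := htrans (-t) t 0 ht
        rw [add_zero, neg_add_cancel] at this
        exact this.symm }
  have hK : ∀ s t, φ s = φ t ↔ -t + s ∈ K := fun s t => by
    change _ ↔ φ (-t + s) = φ 0
    constructor
    · intro h
      rw [htrans (-t) s t h, neg_add_cancel]
    · intro h
      simpa using htrans t _ _ h
  have hnd : ¬ Dense (K : Set ℝ) := by
    intro hd
    obtain ⟨Φ, h0, hΦ⟩ := hloc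
    obtain ⟨ε, hε, hball⟩ := Metric.isOpen_iff.1 Φ.open_source 0 h0
    obtain ⟨t, ht, ht0, htε⟩ := hd.exists_between hε
    have hts : t ∈ Φ.source := hball (by simpa [abs_of_pos ht0] using htε)
    have h1 : φ t = φ 0 := ht
    rw [hΦ hts, hΦ h0] at h1
    exact ht0.ne' (Φ.injOn hts h0 h1)
  obtain ⟨a, ha⟩ := K.dense_or_cyclic.resolve_left hnd
  by_cases ha0 : a = 0
  · left
    intro s t hst
    rw [hK, ha, ha0, AddSubgroup.closure_singleton_zero, AddSubgroup.mem_bot] at hst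
    linarith
  · refine Or.inr ⟨a, ha0, fun s t => ?_⟩
    rw [hK, ha, AddSubgroup.mem_closure_singleton]
    refine exists_congr fun k => ?_
    rw [zsmul_eq_mul]
    constructor <;> intro h <;> linarith

/-! ### Pullbacks of constant bilinear forms -/

section Metric

variable {F : Type*} [NormedAddCommGroup F] [NormedSpace ℝ F]
  {X : Type*} [TopologicalSpace X] [ChartedSpace F X] [IsManifold 𝓘(ℝ, F) ω X]
  {V : Type*}

/-- The pullback by `f : X → V` of the constant bilinear form `B` on `V`, as a field of continuous
bilinear forms on the tangent spaces of `X`. -/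
noncomputable def pullbackForm [NormedAddCommGroup V] [NormedSpace ℝ V]
    (B : V →L[ℝ] V →L[ℝ] ℝ) (f : X → V) (x : X) :
    TangentSpace 𝓘(ℝ, F) x →L[ℝ] TangentSpace 𝓘(ℝ, F) x →L[ℝ] ℝ :=
  let D : TangentSpace 𝓘(ℝ, F) x →L[ℝ] V := mfderiv 𝓘(ℝ, F) 𝓘(ℝ, V) f x
  (ContinuousLinearMap.precomp ℝ D).comp (B.comp D)

omit [IsManifold 𝓘(ℝ, F) ω X] in
/-- The pullback of a fixed bilinear form by an analytic family of linear maps is analytic. -/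
theorem contMDiffAt_precomp_comp [NormedAddCommGroup V] [NormedSpace ℝ V]
    (B : V →L[ℝ] V →L[ℝ] ℝ) {D : X → F →L[ℝ] V} {x₀ : X}
    (hD : ContMDiffAt 𝓘(ℝ, F) 𝓘(ℝ, F →L[ℝ] V) ω D x₀) :
    ContMDiffAt 𝓘(ℝ, F) 𝓘(ℝ, F →L[ℝ] F →L[ℝ] ℝ) ω (fun x =>
      ((D x).precomp ℝ).comp (B.comp (D x))) x₀ := by
  have h1 : ContMDiffAt 𝓘(ℝ, F) 𝓘(ℝ, F →L[ℝ] V →L[ℝ] ℝ) ω (fun x => B.comp (D x)) x₀ :=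
    (contMDiffAt_const (c := B)).clm_comp hD
  have h2 : ContMDiffAt 𝓘(ℝ, F) 𝓘(ℝ, (V →L[ℝ] ℝ) →L[ℝ] (F →L[ℝ] ℝ)) ω
    (fun x => (D x).precomp ℝ) x₀ := hD.clm_precomp
  exact h2.clm_comp h1

/-- In the tangent coordinates at `x₀`, the pullback of a constant form by `f` is expressed through
the coordinate expression of the derivative of `f`. -/
theorem inCoordinates_pullbackForm [NormedAddCommGroup V] [NormedSpace ℝ V]
    (B : V →L[ℝ] V →L[ℝ] ℝ) {f : X → V} {x₀ x : X} (hx : x ∈ (chartAt F x₀).source) (v w : F) :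
    ContinuousLinearMap.inCoordinates F (TangentSpace 𝓘(ℝ, F)) (F →L[ℝ] ℝ)
      (fun x : X => TangentSpace 𝓘(ℝ, F) x →L[ℝ] ℝ) x₀ x x₀ x (pullbackForm B f x) v w =
    B (inTangentCoordinates 𝓘(ℝ, F) 𝓘(ℝ, V) id f (mfderiv 𝓘(ℝ, F) 𝓘(ℝ, V) f) x₀ x v)
      (inTangentCoordinates 𝓘(ℝ, F) 𝓘(ℝ, V) id f (mfderiv 𝓘(ℝ, F) 𝓘(ℝ, V) f) x₀ x w) := by
  have hx' : x ∈ (trivializationAt F (TangentSpace 𝓘(ℝ, F)) x₀).baseSet := by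
    rwa [TangentBundle.trivializationAt_baseSet]
  have key := inCoordinates_apply_eq₂ (F₁ := F) (F₂ := F) (F₃ := ℝ) (E₁ := TangentSpace 𝓘(ℝ, F))
    (E₂ := TangentSpace 𝓘(ℝ, F)) (E₃ := Bundle.Trivial X ℝ) (x₀ := x₀) (x := x)
    (ϕ := pullbackForm B f x) (v := v) (w := w) hx' hx' (by simp)
  have hD : ∀ v : F,
      inTangentCoordinates 𝓘(ℝ, F) 𝓘(ℝ, V) id f (mfderiv 𝓘(ℝ, F) 𝓘(ℝ, V) f) x₀ x v =
        mfderiv 𝓘(ℝ, F) 𝓘(ℝ, V) f x ((trivializationAt F (TangentSpace 𝓘(ℝ, F)) x₀).symm x v) := by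
    intro v
    unfold inTangentCoordinates ContinuousLinearMap.inCoordinates
    rw [TangentBundle.continuousLinearMapAt_model_space]
    change mfderiv 𝓘(ℝ, F) 𝓘(ℝ, V) f x
      ((trivializationAt F (TangentSpace 𝓘(ℝ, F)) x₀).symmL ℝ x v) = _
    rw [Trivialization.symmL_apply _ hx']
  rw [hD, hD]
  refine key.trans ?_
  simp only [Trivial.fiberBundle_trivializationAt', Trivial.linearMapAt_trivialization,
    LinearMap.id_coe, id_eq]
  rfl

theorem contMDiff_pullbackForm [NormedAddCommGroup V] [NormedSpace ℝ V]
    (B : V →L[ℝ] V →L[ℝ] ℝ) {f : X → V} (hf : ContMDiff 𝓘(ℝ, F) 𝓘(ℝ, V) ω f) :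
    ContMDiff 𝓘(ℝ, F) (𝓘(ℝ, F).prod 𝓘(ℝ, F →L[ℝ] F →L[ℝ] ℝ)) ω
      (fun x => TotalSpace.mk' (F →L[ℝ] F →L[ℝ] ℝ)
        (E := fun x : X => TangentSpace 𝓘(ℝ, F) x →L[ℝ] TangentSpace 𝓘(ℝ, F) x →L[ℝ] ℝ)
        x (pullbackForm B f x)) := by
  intro x₀
  rw [contMDiffAt_hom_bundle]
  refine ⟨contMDiffAt_id, ?_⟩
  have hD : ContMDiffAt 𝓘(ℝ, F) 𝓘(ℝ, F →L[ℝ] V) ω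
    (inTangentCoordinates 𝓘(ℝ, F) 𝓘(ℝ, V) id f (mfderiv 𝓘(ℝ, F) 𝓘(ℝ, V) f) x₀) x₀ :=
    (hf x₀).mfderiv_const (by simp)
  refine (contMDiffAt_precomp_comp B hD).congr_of_eventuallyEq ?_
  filter_upwards [(chartAt F x₀).open_source.mem_nhds (mem_chart_source F x₀)] with x hx
  ext v w
  exact inCoordinates_pullbackForm B hx v w

end Metric

/-! ### Metrics induced by maps to inner product spaces -/

section Metric

variable {F : Type*} [NormedAddCommGroup F] [NormedSpace ℝ F]
  {X : Type*} [TopologicalSpace X] [ChartedSpace F X]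
  {V : Type*} [NormedAddCommGroup V] [InnerProductSpace ℝ V]

/-- The boundedness of unit balls that is part of the definition of a Riemannian metric: in finite
dimension, an injective derivative is bounded below. -/
theorem isVonNBounded_pullbackMetric [FiniteDimensional ℝ F] {f : X → V} {x : X}
    (hinj : ∀ v : TangentSpace 𝓘(ℝ, F) x, mfderiv 𝓘(ℝ, F) 𝓘(ℝ, V) f x v = 0 → v = 0) :
    Bornology.IsVonNBounded ℝ {v : TangentSpace 𝓘(ℝ, F) x | pullbackMetric f x v v < 1} := by
  let D : F →L[ℝ] V := mfderiv 𝓘(ℝ, F) 𝓘(ℝ, V) f x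
  have hker : LinearMap.ker (D : F →ₗ[ℝ] V) = ⊥ := LinearMap.ker_eq_bot'.2 fun v hv => hinj v hv
  obtain ⟨K, -, hK⟩ := LinearMap.exists_antilipschitzWith (D : F →ₗ[ℝ] V) hker
  suffices h : Bornology.IsVonNBounded ℝ {v : F | inner ℝ (D v) (D v) < 1} from h
  refine NormedSpace.isVonNBounded_of_isBounded ℝ
    ((Metric.isBounded_closedBall (x := (0 : F)) (r := K)).subset fun v hv => ?_)
  have h1 : ‖D v‖ ≤ 1 := by
    have h2 : inner ℝ (D v) (D v) < 1 := hv
    rw [real_inner_self_eq_norm_sq] at h2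
    nlinarith [norm_nonneg (D v)]
  have h3 := hK.le_mul_dist v 0
  simp only [dist_zero_right, map_zero] at h3
  rw [mem_closedBall_zero_iff]
  exact h3.trans (mul_le_of_le_one_right K.coe_nonneg h1)

theorem exists_contMDiffRiemannianMetric_eq_pullbackMetric [IsManifold 𝓘(ℝ, F) ω X]
    [FiniteDimensional ℝ F] {f : X → V} (hf : ContMDiff 𝓘(ℝ, F) 𝓘(ℝ, V) ω f)
    (hinj : ∀ x (v : TangentSpace 𝓘(ℝ, F) x), mfderiv 𝓘(ℝ, F) 𝓘(ℝ, V) f x v = 0 → v = 0) :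
    ∃ g : ContMDiffRiemannianMetric 𝓘(ℝ, F) ω F (fun x : X => TangentSpace 𝓘(ℝ, F) x),
      ∀ (x : X) (v w : TangentSpace 𝓘(ℝ, F) x), g.inner x v w = pullbackMetric f x v w := by
  refine ⟨⟨pullbackForm (innerSL ℝ) f, fun x v w => ?_, fun x v hv => ?_,
    fun x => isVonNBounded_pullbackMetric (hinj x), contMDiff_pullbackForm _ hf⟩,
    fun x v w => rfl⟩
  · exact real_inner_comm _ _
  · exact real_inner_self_pos.2 fun h => hv (hinj x v h)

theorem isInvariantMetric_pullbackMetric {E : Type*} [NormedAddCommGroup E] [NormedSpace ℝ E]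
    {N : Type*} [TopologicalSpace N] [ChartedSpace E N] [Group N] [MulAction N X]
    [ContMDiffSMul 𝓘(ℝ, E) 𝓘(ℝ, F) ω N X]
    {f : X → V} (hf : ContMDiff 𝓘(ℝ, F) 𝓘(ℝ, V) ω f)
    (hN : ∀ n : N, ∃ (L : V →ₗᵢ[ℝ] V) (b : V), ∀ x, f (n • x) = L (f x) + b)
    {g : ∀ x : X, TangentSpace 𝓘(ℝ, F) x →L[ℝ] TangentSpace 𝓘(ℝ, F) x →L[ℝ] ℝ}
    (hg : ∀ (x : X) (v w : TangentSpace 𝓘(ℝ, F) x), g x v w = pullbackMetric f x v w) :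
    IsInvariantMetric N g := by
  have hω : (ω : WithTop ℕ∞) ≠ 0 := by simp
  intro n x v w
  obtain ⟨L, b, hL⟩ := hN n
  have hn : MDifferentiableAt 𝓘(ℝ, F) 𝓘(ℝ, F) (fun y : X => n • y) x :=
    (ContMDiffSMul.contMDiff_const_smul (I := 𝓘(ℝ, E)) n).mdifferentiable hω x
  have h1 := (hf.mdifferentiable hω (n • x)).hasMFDerivAt.comp x hn.hasMFDerivAt
  have hLd : HasMFDerivAt 𝓘(ℝ, V) 𝓘(ℝ, V) (fun y => L y + b) (f x) L.toContinuousLinearMap :=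
    (L.toContinuousLinearMap.hasFDerivAt.add_const b).hasMFDerivAt
  have h2 := hLd.comp x (hf.mdifferentiable hω x).hasMFDerivAt
  have hfun : f ∘ (fun y : X => n • y) = (fun y => L y + b) ∘ f := funext hL
  rw [hfun] at h1
  have h3 := hasMFDerivAt_unique h1 h2
  have h4 : ∀ v : TangentSpace 𝓘(ℝ, F) x, mfderiv 𝓘(ℝ, F) 𝓘(ℝ, V) f (n • x)
      (mfderiv 𝓘(ℝ, F) 𝓘(ℝ, F) (fun y : X => n • y) x v) =
        L (mfderiv 𝓘(ℝ, F) 𝓘(ℝ, V) f x v : V) := fun v => congrArg (fun A : F →L[ℝ] V => A v) h3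
  rw [hg, hg]
  unfold pullbackMetric
  rw [h4, h4]
  exact L.inner_map_map _ _

variable (E : Type*) [NormedAddCommGroup E] [NormedSpace ℝ E]
    {N : Type*} [TopologicalSpace N] [ChartedSpace E N] [Group N] [MulAction N X]
    [ContMDiffSMul 𝓘(ℝ, E) 𝓘(ℝ, F) ω N X] in
include E in
/-- Two invariant metrics are proportional at one point because the tangent space is a line, and the
factor is the same everywhere because the action is transitive. -/
theorem IsInvariantMetric.eq_const_mul [Nonempty X] [MulAction.IsPretransitive N X]
    (hF : Module.finrank ℝ F = 1)
    {g g' : ∀ x : X, TangentSpace 𝓘(ℝ, F) x →L[ℝ] TangentSpace 𝓘(ℝ, F) x →L[ℝ] ℝ}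
    (hg : IsInvariantMetric N g) (hg' : IsInvariantMetric N g')
    (hpos : ∀ x v, v ≠ 0 → 0 < g x v v) (hpos' : ∀ x v, v ≠ 0 → 0 < g' x v v) :
    ∃ c : ℝ, 0 < c ∧ ∀ (x : X) (v w : TangentSpace 𝓘(ℝ, F) x), g' x v w = c * g x v w := by
  have hω : (ω : WithTop ℕ∞) ≠ 0 := by simp
  obtain ⟨x₀⟩ := ‹Nonempty X›
  obtain ⟨v₀, hv₀, hspan⟩ : ∃ v₀ : F, v₀ ≠ 0 ∧ ∀ w : F, ∃ a : ℝ, a • v₀ = w :=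
    finrank_eq_one_iff'.1 hF
  let v₁ : TangentSpace 𝓘(ℝ, F) x₀ := v₀
  refine ⟨g' x₀ v₁ v₁ / g x₀ v₁ v₁, div_pos (hpos' x₀ v₁ hv₀) (hpos x₀ v₁ hv₀), ?_⟩
  have h0 : ∀ v w : TangentSpace 𝓘(ℝ, F) x₀,
      g' x₀ v w = g' x₀ v₁ v₁ / g x₀ v₁ v₁ * g x₀ v w := by
    intro v w
    obtain ⟨a, rfl⟩ := hspan v
    obtain ⟨b, rfl⟩ := hspan w
    have h1 : g x₀ v₁ v₁ ≠ 0 := (hpos x₀ v₁ hv₀).ne'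
    have h2 : g x₀ (a • v₁) (b • v₁) = a * (b * g x₀ v₁ v₁) := by simp; ring
    have h3 : g' x₀ (a • v₁) (b • v₁) = a * (b * g' x₀ v₁ v₁) := by simp; ring
    refine h3.trans (Eq.trans ?_ (congrArg _ h2.symm))
    field_simp
  intro x v w
  obtain ⟨n, rfl⟩ := MulAction.exists_smul_eq N x₀ x
  have hsurj : ∀ v : TangentSpace 𝓘(ℝ, F) (n • x₀), ∃ u : TangentSpace 𝓘(ℝ, F) x₀,
      mfderiv 𝓘(ℝ, F) 𝓘(ℝ, F) (fun y : X => n • y) x₀ u = v := fun v =>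
    ((Diffeomorph.smul 𝓘(ℝ, E) 𝓘(ℝ, F) ω n (M := X)).mfderivToContinuousLinearEquiv
      hω x₀).surjective v
  obtain ⟨v, rfl⟩ := hsurj v
  obtain ⟨w, rfl⟩ := hsurj w
  rw [hg, hg', h0]

end Metric

/-! ### Maps of unit speed along the developing map -/

section UnitSpeed

variable {F : Type*} [NormedAddCommGroup F] [NormedSpace ℝ F]
  {X : Type*} [TopologicalSpace X] [ChartedSpace F X]
  {V : Type*} [NormedAddCommGroup V] [InnerProductSpace ℝ V]
  {φ : ℝ → X} {f : X → V} {w : ℝ → V}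

theorem contMDiff_of_comp_isLocalDiffeomorph (hloc : IsLocalDiffeomorph 𝓘(ℝ, ℝ) 𝓘(ℝ, F) ω φ)
    (hsurj : Function.Surjective φ) (hf : ContDiff ℝ ω (f ∘ φ)) :
    ContMDiff 𝓘(ℝ, F) 𝓘(ℝ, V) ω f := by
  intro x
  obtain ⟨t, rfl⟩ := hsurj x
  have h1 : ContMDiffAt 𝓘(ℝ, F) 𝓘(ℝ, V) ω ((f ∘ φ) ∘ (hloc t).localInverse) (φ t) :=
    hf.contMDiff.contMDiffAt.comp _ (hloc t).localInverse_contMDiffAt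
  refine h1.congr_of_eventuallyEq ?_
  filter_upwards [(hloc t).localInverse_eventuallyEq_right] with y hy
  exact congrArg f hy.symm

/-- If `κ` is a local inverse of `φ`, then `df` is the product of `dκ` with the velocity `w` of
`f ∘ φ`. -/
theorem mfderiv_eq_smul_of_hasDerivAt_comp (hw : ∀ t, HasDerivAt (f ∘ φ) (w t) t)
    (κ : PartialDiffeomorph 𝓘(ℝ, F) 𝓘(ℝ, ℝ) X ℝ ω) (hκ : ∀ y ∈ κ.source, φ (κ y) = y)
    {y : X} (hy : y ∈ κ.source) (v : TangentSpace 𝓘(ℝ, F) y) :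
    (mfderiv 𝓘(ℝ, F) 𝓘(ℝ, V) f y v : V) =
      HSMul.hSMul (α := ℝ) (mfderiv 𝓘(ℝ, F) 𝓘(ℝ, ℝ) κ y v) (w (κ y)) := by
  have hω : (ω : WithTop ℕ∞) ≠ 0 := by simp
  have h1 := (hw (κ y)).hasFDerivAt.hasMFDerivAt.comp y (κ.mdifferentiableAt hω hy).hasMFDerivAt
  have heq : f =ᶠ[𝓝 y] (f ∘ φ) ∘ κ := by
    filter_upwards [κ.open_source.mem_nhds hy] with z hz
    exact congrArg f (hκ z hz).symm
  rw [(h1.congr_of_eventuallyEq heq).mfderiv]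
  rfl

/-- If `f ∘ φ` has unit speed, the metric induced by `f` is the Euclidean metric in the coordinate
given by a local inverse `κ` of `φ`. -/
theorem pullbackMetric_eq_of_unit_speed (hw : ∀ t, HasDerivAt (f ∘ φ) (w t) t)
    (hw1 : ∀ t, ‖w t‖ = 1)
    (κ : PartialDiffeomorph 𝓘(ℝ, F) 𝓘(ℝ, ℝ) X ℝ ω) (hκ : ∀ y ∈ κ.source, φ (κ y) = y)
    {y : X} (hy : y ∈ κ.source) (v v' : TangentSpace 𝓘(ℝ, F) y) :
    pullbackMetric f y v v' = pullbackMetric κ y v v' := by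
  have key : ∀ (a b : ℝ) (u : V), ‖u‖ = 1 → inner ℝ (a • u) (b • u) = inner ℝ a b := by
    intro a b u hu
    rw [real_inner_smul_left, real_inner_smul_right, real_inner_self_eq_norm_sq, hu]
    simp [mul_comm]
  unfold pullbackMetric
  rw [mfderiv_eq_smul_of_hasDerivAt_comp hw κ hκ hy, mfderiv_eq_smul_of_hasDerivAt_comp hw κ hκ hy]
  exact key _ _ _ (hw1 _)

theorem mfderiv_injective_of_unit_speed (hloc : IsLocalDiffeomorph 𝓘(ℝ, ℝ) 𝓘(ℝ, F) ω φ)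
    (hsurj : Function.Surjective φ) (hw : ∀ t, HasDerivAt (f ∘ φ) (w t) t)
    (hw1 : ∀ t, ‖w t‖ = 1) (x : X) (v : TangentSpace 𝓘(ℝ, F) x)
    (hv : mfderiv 𝓘(ℝ, F) 𝓘(ℝ, V) f x v = 0) : v = 0 := by
  have hω : (ω : WithTop ℕ∞) ≠ 0 := by simp
  obtain ⟨t, rfl⟩ := hsurj x
  have h1 := (mfderiv_eq_smul_of_hasDerivAt_comp hw (hloc t).localInverse
    (fun y hy => (hloc t).localInverse_right_inv hy) (hloc t).localInverse_mem_source
    v).symm.trans hv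
  have hw0 : w ((hloc t).localInverse (φ t)) ≠ 0 := fun h => by
    simpa [h] using hw1 ((hloc t).localInverse (φ t))
  have h2 := (smul_eq_zero.1 h1).resolve_right hw0
  exact ((hloc t).localInverse_isLocalDiffeomorphAt.mfderivToContinuousLinearEquiv hω).injective
    (h2.trans (map_zero _).symm)

theorem isFlatMetric_of_unit_speed (hF : Module.finrank ℝ F = 1)
    (hloc : IsLocalDiffeomorph 𝓘(ℝ, ℝ) 𝓘(ℝ, F) ω φ)
    (hsurj : Function.Surjective φ) (hw : ∀ t, HasDerivAt (f ∘ φ) (w t) t)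
    (hw1 : ∀ t, ‖w t‖ = 1)
    {g : ∀ x : X, TangentSpace 𝓘(ℝ, F) x →L[ℝ] TangentSpace 𝓘(ℝ, F) x →L[ℝ] ℝ}
    (hg : ∀ (x : X) (v w : TangentSpace 𝓘(ℝ, F) x), g x v w = pullbackMetric f x v w) :
    IsFlatMetric g := by
  have hω : (ω : WithTop ℕ∞) ≠ 0 := by simp
  intro x
  obtain ⟨t, rfl⟩ := hsurj x
  let κ := (hloc t).localInverse
  -- The coordinate is the local inverse of `φ`, with `ℝ` regarded as the Euclidean space of
  -- dimension `finrank ℝ F = 1`.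
  let L : ℝ ≃ₗᵢ[ℝ] EuclideanSpace ℝ (Fin (Module.finrank ℝ F)) :=
    ((stdOrthonormalBasis ℝ ℝ).reindex
      (finCongr ((Module.finrank_self ℝ).trans hF.symm))).repr
  have hLc : ContMDiff 𝓘(ℝ, ℝ) (𝓡 (Module.finrank ℝ F)) ω L :=
    L.toContinuousLinearEquiv.contDiff.contMDiff
  have hLs : ContMDiff (𝓡 (Module.finrank ℝ F)) 𝓘(ℝ, ℝ) ω L.symm :=
    L.symm.toContinuousLinearEquiv.contDiff.contMDiff
  refine ⟨κ.toOpenPartialHomeomorph.transHomeomorph L.toHomeomorph,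
    (hloc t).localInverse_mem_source, ?_, ?_, ?_⟩
  · exact hLc.comp_contMDiffOn κ.contMDiffOn
  · exact κ.symm.contMDiffOn.comp hLs.contMDiffOn fun z hz => hz
  · intro y hy v v'
    have hy' : y ∈ κ.source := hy
    rw [hg, pullbackMetric_eq_of_unit_speed hw hw1 κ
      (fun y hy => (hloc t).localInverse_right_inv hy) hy']
    have h1 : HasMFDerivAt 𝓘(ℝ, F) (𝓡 (Module.finrank ℝ F)) (L ∘ κ) y
        ((L.toContinuousLinearEquiv : ℝ →L[ℝ] EuclideanSpace ℝ (Fin (Module.finrank ℝ F))).comp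
          (mfderiv 𝓘(ℝ, F) 𝓘(ℝ, ℝ) κ y)) :=
      (L.toContinuousLinearEquiv.hasFDerivAt.hasMFDerivAt).comp y
        (κ.mdifferentiableAt hω hy').hasMFDerivAt
    have h2 : ∀ v : TangentSpace 𝓘(ℝ, F) y,
        (mfderiv 𝓘(ℝ, F) (𝓡 (Module.finrank ℝ F)) (L ∘ κ) y v :
          EuclideanSpace ℝ (Fin (Module.finrank ℝ F))) =
          L (mfderiv 𝓘(ℝ, F) 𝓘(ℝ, ℝ) κ y v : ℝ) := fun v => by rw [h1.mfderiv]; rfl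
    change _ = pullbackMetric (L ∘ κ) y v v'
    unfold pullbackMetric
    rw [h2, h2]
    exact (L.inner_map_map _ _).symm

end UnitSpeed

/-! ### The exponential map of the circle -/

theorem hasDerivAt_coe_circleExp (t : ℝ) :
    HasDerivAt (fun s : ℝ => (Circle.exp s : ℂ)) (Circle.exp t * Complex.I) t := by
  simp only [Circle.coe_exp]
  simpa using ((Complex.ofRealCLM.hasDerivAt (x := t)).mul_const Complex.I).cexp

theorem isLocalDiffeomorph_circleExp :
    IsLocalDiffeomorph 𝓘(ℝ, ℝ) (𝓡 1) ω Circle.exp := by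
  have hω : (ω : WithTop ℕ∞) ≠ 0 := by simp
  intro t
  refine isLocalDiffeomorphAt_of_mfderiv_ne_zero finrank_euclideanSpace_fin
    (contMDiff_circleExp t) fun h0 => ?_
  have h1 : HasMFDerivAt 𝓘(ℝ, ℝ) (𝓡 1) Circle.exp t
      (mfderiv 𝓘(ℝ, ℝ) (𝓡 1) Circle.exp t) :=
    (contMDiff_circleExp.mdifferentiable hω t).hasMFDerivAt
  have : Fact (Module.finrank ℝ ℂ = 1 + 1) := ⟨Complex.finrank_real_complex⟩
  have h2 : ContMDiff (𝓡 1) 𝓘(ℝ, ℂ) ω (fun z : Circle => (z : ℂ)) := contMDiff_coe_sphere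
  have h3 := (h2.mdifferentiable hω (Circle.exp t)).hasMFDerivAt.comp t h1
  rw [h0] at h3
  have h4 : HasFDerivAt (fun s : ℝ => (Circle.exp s : ℂ)) (0 : ℝ →L[ℝ] ℂ) t := by
    refine HasFDerivAt.congr_fderiv (hasMFDerivAt_iff_hasFDerivAt.1 h3) ?_
    exact ContinuousLinearMap.comp_zero _
  have h5 := (hasDerivAt_coe_circleExp t).unique h4.hasDerivAt
  have h6 : (0 : ℂ) = (Circle.exp t : ℂ) * Complex.I := h5.symm
  simp at h6

/-! ### Identifying the manifold with its model -/

section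

variable {F F' : Type*} [NormedAddCommGroup F] [NormedSpace ℝ F]
  [NormedAddCommGroup F'] [NormedSpace ℝ F']
  {X A : Type*} [TopologicalSpace X] [ChartedSpace F X] [TopologicalSpace A] [ChartedSpace F' A]

/-- Two surjective local diffeomorphisms from `ℝ` with the same fibres have diffeomorphic targets.
-/
theorem exists_diffeomorph_comp_eq {φ : ℝ → X} {p : ℝ → A}
    (hφ : IsLocalDiffeomorph 𝓘(ℝ, ℝ) 𝓘(ℝ, F) ω φ) (hφs : Function.Surjective φ)
    (hp : IsLocalDiffeomorph 𝓘(ℝ, ℝ) 𝓘(ℝ, F') ω p) (hps : Function.Surjective p)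
    (h : ∀ s t, φ s = φ t ↔ p s = p t) :
    ∃ Φ : X ≃ₘ^ω⟮𝓘(ℝ, F), 𝓘(ℝ, F')⟯ A, ∀ s, Φ (φ s) = p s := by
  have hs : ∀ x, φ (Function.surjInv hφs x) = x := Function.surjInv_eq hφs
  have ht : ∀ a, p (Function.surjInv hps a) = a := Function.surjInv_eq hps
  have h1 : ∀ s, p (Function.surjInv hφs (φ s)) = p s := fun s => (h _ _).1 (hs _)
  have h2 : ∀ s, φ (Function.surjInv hps (p s)) = φ s := fun s => (h _ _).2 (ht _)
  refine ⟨⟨⟨fun x => p (Function.surjInv hφs x), fun a => φ (Function.surjInv hps a),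
    fun x => ?_, fun a => ?_⟩, fun x => ?_, fun a => ?_⟩, h1⟩
  · simp only [h2, hs]
  · simp only [h1, ht]
  · obtain ⟨t, rfl⟩ := hφs x
    refine (hp.contMDiff.contMDiffAt.comp _
      (hφ t).localInverse_contMDiffAt).congr_of_eventuallyEq ?_
    filter_upwards [(hφ t).localInverse_eventuallyEq_right] with y hy
    have hy' : φ ((hφ t).localInverse y) = y := hy
    change p (Function.surjInv hφs y) = p ((hφ t).localInverse y)
    rw [← h1 ((hφ t).localInverse y), hy']
  · obtain ⟨t, rfl⟩ := hps a
    refine (hφ.contMDiff.contMDiffAt.comp _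
      (hp t).localInverse_contMDiffAt).congr_of_eventuallyEq ?_
    filter_upwards [(hp t).localInverse_eventuallyEq_right] with y hy
    have hy' : p ((hp t).localInverse y) = y := hy
    change φ (Function.surjInv hps y) = φ ((hp t).localInverse y)
    rw [← h2 ((hp t).localInverse y), hy']

end

/-! ### The invariant flat metric -/

section

variable (E : Type*) [NormedAddCommGroup E] [NormedSpace ℝ E]
  (N : Type*) [TopologicalSpace N] [ChartedSpace E N] [Group N]
  {F : Type*} [NormedAddCommGroup F] [NormedSpace ℝ F]
  {X : Type*} [TopologicalSpace X] [ChartedSpace F X] [IsManifold 𝓘(ℝ, F) ω X]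
  [MulAction N X] [ContMDiffSMul 𝓘(ℝ, E) 𝓘(ℝ, F) ω N X] [MulAction.IsPretransitive N X]
  {V : Type*} [NormedAddCommGroup V] [InnerProductSpace ℝ V]

include E in
/-- If `f` has unit speed along a surjective local diffeomorphism `φ : ℝ → X`, and `N` acts on the
values of `f` by isometries of `V`, then `f` induces an invariant flat metric on `X`, which is
unique up to a constant. -/
theorem exists_unique_flat_invariant_metric (hF : Module.finrank ℝ F = 1)
    {φ : ℝ → X} {f : X → V} {w : ℝ → V}
    (hloc : IsLocalDiffeomorph 𝓘(ℝ, ℝ) 𝓘(ℝ, F) ω φ) (hsurj : Function.Surjective φ)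
    (hf : ContDiff ℝ ω (f ∘ φ)) (hw : ∀ t, HasDerivAt (f ∘ φ) (w t) t) (hw1 : ∀ t, ‖w t‖ = 1)
    (hN : ∀ n : N, ∃ (L : V →ₗᵢ[ℝ] V) (b : V), ∀ x, f (n • x) = L (f x) + b) :
    ∃ g : ContMDiffRiemannianMetric 𝓘(ℝ, F) ω F (fun x : X => TangentSpace 𝓘(ℝ, F) x),
      (∀ (x : X) (v w : TangentSpace 𝓘(ℝ, F) x), g.inner x v w = pullbackMetric f x v w) ∧
      IsInvariantMetric N g.inner ∧ IsFlatMetric g.inner ∧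
      ∀ g' : ContinuousRiemannianMetric F (fun x : X => TangentSpace 𝓘(ℝ, F) x),
        IsInvariantMetric N g'.inner →
        ∃ c : ℝ, 0 < c ∧ ∀ (x : X) (v w : TangentSpace 𝓘(ℝ, F) x),
          g'.inner x v w = c * g.inner x v w := by
  have : FiniteDimensional ℝ F := Module.finite_of_finrank_eq_succ hF
  have : Nonempty X := ⟨φ 0⟩
  have hfX := contMDiff_of_comp_isLocalDiffeomorph hloc hsurj hf
  obtain ⟨g, hg⟩ := exists_contMDiffRiemannianMetric_eq_pullbackMetric hfX
    (mfderiv_injective_of_unit_speed hloc hsurj hw hw1)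
  have hinv : IsInvariantMetric N g.inner :=
    isInvariantMetric_pullbackMetric (E := E) hfX hN hg
  exact ⟨g, hg, hinv, isFlatMetric_of_unit_speed hF hloc hsurj hw hw1 hg,
    fun g' hg' => hinv.eq_const_mul E hF hg' g.pos g'.pos⟩

end

end LineAction

/-! ### Nilpotent actions without fixed points -/

theorem mainTheorem5
    {E : Type*} [NormedAddCommGroup E] [NormedSpace ℝ E] [FiniteDimensional ℝ E]
    {N : Type*} [TopologicalSpace N] [ChartedSpace E N] [Group N]
    [LieGroup 𝓘(ℝ, E) ω N] [ConnectedSpace N] [Group.IsNilpotent N]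
    {F : Type*} [NormedAddCommGroup F] [NormedSpace ℝ F] (hF : Module.finrank ℝ F = 1)
    {X : Type*} [TopologicalSpace X] [ChartedSpace F X] [IsManifold 𝓘(ℝ, F) ω X]
    [T2Space X] [SecondCountableTopology X] [ConnectedSpace X]
    [MulAction N X] [ContMDiffSMul 𝓘(ℝ, E) 𝓘(ℝ, F) ω N X]
    (hfix : ¬ ∃ x : X, ∀ n : N, n • x = x) :
    ∃ g : ContMDiffRiemannianMetric 𝓘(ℝ, F) ω F (fun x : X => TangentSpace 𝓘(ℝ, F) x),
      LineAction.IsInvariantMetric N g.inner ∧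
      LineAction.IsFlatMetric g.inner ∧
      (∀ g' : ContinuousRiemannianMetric F (fun x : X => TangentSpace 𝓘(ℝ, F) x),
        LineAction.IsInvariantMetric N g'.inner →
        ∃ c : ℝ, 0 < c ∧ ∀ (x : X) (v w : TangentSpace 𝓘(ℝ, F) x),
          g'.inner x v w = c * g.inner x v w) ∧
      ((∃ (Φ : X ≃ₘ^ω⟮𝓘(ℝ, F), 𝓘(ℝ, ℝ)⟯ ℝ) (ρ : N →* Multiplicative ℝ),
          ContMDiff 𝓘(ℝ, E) 𝓘(ℝ, ℝ) ω (fun n : N => (ρ n).toAdd) ∧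
          (∀ (n : N) (x : X), Φ (n • x) = (ρ n).toAdd + Φ x) ∧
          ∃ c : ℝ, 0 < c ∧ ∀ (x : X) (v w : TangentSpace 𝓘(ℝ, F) x),
            g.inner x v w = c * LineAction.pullbackMetric (fun y : X => Φ y) x v w) ∨
        (∃ (Φ : X ≃ₘ^ω⟮𝓘(ℝ, F), 𝓡 1⟯ Circle) (ρ : N →* Circle),
          ContMDiff 𝓘(ℝ, E) (𝓡 1) ω ρ ∧
          (∀ (n : N) (x : X), Φ (n • x) = ρ n * Φ x) ∧
          ∃ c : ℝ, 0 < c ∧ ∀ (x : X) (v w : TangentSpace 𝓘(ℝ, F) x),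
            g.inner x v w = c * LineAction.pullbackMetric (fun y : X => (Φ y : ℂ)) x v w)) := by
  have htrans : MulAction.IsPretransitive N X :=
    LineAction.isPretransitive_of_no_fixedPoint E hF hfix
  have hcomm := LineAction.smul_smul_comm_of_isPretransitive E (N := N) (X := X) hF
  obtain ⟨x₀⟩ : Nonempty X := inferInstance
  obtain ⟨n₀, hn₀⟩ : ∃ n : N, n • x₀ ≠ x₀ := by
    by_contra! h
    exact hfix ⟨x₀, h⟩
  obtain ⟨φ, hloc, hsurj, hφ, hφ'⟩ :=
    LineAction.exists_equivariant_isLocalDiffeomorph E hF hcomm hn₀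
  have hshift : ∀ r s t, φ s = φ t → φ (r + s) = φ (r + t) := by
    intro r s t hst
    obtain ⟨n, hn⟩ := hφ' r
    rw [← hn, ← hn, hst]
  have horbit : ∀ x : X, ContMDiff 𝓘(ℝ, E) 𝓘(ℝ, F) ω (fun n : N => n • x) := fun x =>
    contMDiff_id.smul (I := 𝓘(ℝ, E)) contMDiff_const
  -- If `φ` is injective, its inverse identifies `X` with `ℝ`; otherwise, after rescaling the period
  -- to `2 * π`, `X` is identified with the circle.
  rcases LineAction.injective_or_periodic (hloc 0) hshift with hinj | ⟨a, ha, hper⟩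
  · have hid : IsLocalDiffeomorph 𝓘(ℝ, ℝ) 𝓘(ℝ, ℝ) ω (id : ℝ → ℝ) :=
      (Diffeomorph.refl 𝓘(ℝ, ℝ) ℝ ω).isLocalDiffeomorph
    obtain ⟨Φ, hΦ⟩ := LineAction.exists_diffeomorph_comp_eq hloc hsurj hid
      Function.surjective_id fun s t => hinj.eq_iff
    have hΦ0 : Φ (φ 0) = 0 := hΦ 0
    have hΦN : ∀ (n : N) (x : X), Φ (n • x) = Φ (n • φ 0) + Φ x := by
      intro n x
      obtain ⟨s, rfl⟩ := hsurj x
      obtain ⟨t, ht⟩ := hφ n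
      rw [ht, ht, hΦ, hΦ, hΦ]
      simp
    have hfun : (fun y : X => Φ y) ∘ φ = id := funext hΦ
    obtain ⟨g, hg, hinv, hflat, huniq⟩ := LineAction.exists_unique_flat_invariant_metric E N hF
      (f := fun y : X => Φ y) (w := fun _ => (1 : ℝ)) hloc hsurj (by rw [hfun]; exact contDiff_id)
      (fun t => by rw [hfun]; exact hasDerivAt_id t) (fun _ => norm_one)
      (fun n => ⟨LinearIsometry.id, Φ (n • φ 0), fun x => (hΦN n x).trans (add_comm _ _)⟩)
    refine ⟨g, hinv, hflat, huniq, Or.inl ⟨Φ, MonoidHom.mk'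
      (fun n => Multiplicative.ofAdd (Φ (n • φ 0))) fun m n => ?_, ?_, hΦN, 1, one_pos,
      fun x v w => by rw [one_mul, hg]⟩⟩
    · rw [mul_smul, hΦN, ofAdd_add]
    · exact Φ.contMDiff.comp (horbit (φ 0))
  · have hπ : a / (2 * Real.pi) ≠ 0 := div_ne_zero ha (by positivity)
    -- The summand `0` matches the form of `isLocalDiffeomorphAt_affine`.
    let ψ : ℝ → X := fun s => φ (a / (2 * Real.pi) * s + 0)
    have hψloc : IsLocalDiffeomorph 𝓘(ℝ, ℝ) 𝓘(ℝ, F) ω ψ := fun t =>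
      (LineAction.isLocalDiffeomorphAt_affine hπ 0 t).comp _ _ (hloc _)
    have hψsurj : Function.Surjective ψ := fun x => by
      obtain ⟨t, rfl⟩ := hsurj x
      refine ⟨t / (a / (2 * Real.pi)), ?_⟩
      simp only [ψ, mul_div_cancel₀ t hπ, add_zero]
    have hψ : ∀ n : N, ∃ t, ∀ s, n • ψ s = ψ (t + s) := by
      intro n
      obtain ⟨t, ht⟩ := hφ n
      refine ⟨t / (a / (2 * Real.pi)), fun s => ?_⟩
      simp only [ψ, ht, mul_add, mul_div_cancel₀ t hπ, add_zero]
    have hker : ∀ s t, ψ s = ψ t ↔ Circle.exp s = Circle.exp t := by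
      intro s t
      rw [Circle.exp_eq_exp, hper]
      refine exists_congr fun k => ?_
      simp only [add_zero]
      have h2 : (2 * Real.pi) ≠ 0 := by positivity
      constructor
      · intro h
        field_simp at h
        linarith
      · rintro rfl
        field_simp
    obtain ⟨Φ, hΦ⟩ := LineAction.exists_diffeomorph_comp_eq hψloc hψsurj
      LineAction.isLocalDiffeomorph_circleExp Circle.exp_surjective hker
    have hΦN : ∀ (n : N) (x : X), Φ (n • x) = Φ (n • ψ 0) * Φ x := by
      intro n x
      obtain ⟨s, rfl⟩ := hψsurj x
      obtain ⟨t, ht⟩ := hψ n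
      rw [ht, ht, hΦ, hΦ, hΦ, ← Circle.exp_add, add_zero]
    have hfun : (fun y : X => (Φ y : ℂ)) ∘ ψ = fun t : ℝ => (Circle.exp t : ℂ) :=
      funext fun t => by simp [hΦ]
    obtain ⟨g, hg, hinv, hflat, huniq⟩ := LineAction.exists_unique_flat_invariant_metric E N hF
      (f := fun y : X => (Φ y : ℂ)) (w := fun t => Circle.exp t * Complex.I) hψloc hψsurj
      (by
        rw [hfun]
        simp only [Circle.coe_exp]
        exact (Complex.ofRealCLM.contDiff.mul contDiff_const).cexp)
      (fun t => by rw [hfun]; exact LineAction.hasDerivAt_coe_circleExp t) (fun t => by simp)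
      (fun n => ⟨(rotation (Φ (n • ψ 0))).toLinearIsometry, 0, fun x => by
        rw [hΦN]; simp⟩)
    refine ⟨g, hinv, hflat, huniq, Or.inr ⟨Φ, MonoidHom.mk'
      (fun n => Φ (n • ψ 0)) fun m n => ?_, ?_, hΦN, 1, one_pos,
      fun x v w => by rw [one_mul, hg]⟩⟩
    · rw [mul_smul, hΦN]
    · exact Φ.contMDiff.comp (horbit (ψ 0))
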